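/- Let $\mathbb D$ be the open unit disk. A function $p:(-1,1)\to\mathbb R$ is called a Nehari function if it is positive, even and continuous, $(1-x^2)^2p(x)$ is non-increasing on $[0,1)$, and no nontrivial solution of $u''+pu=0$ has more than one zero in $(-1,1)$. For a holomorphic curve $\phi=(f_1,\dots,f_n):\mathbb D\to\mathbb C^n$ with $\phi'\neq 0$ everywhere, put $\sigma=\tfrac12\log(|f_1'|^2+\cdots+|f_n'|^2)$, $\sigma_z=\tfrac12(\sigma_x-i\sigma_y)$, $\mathcal S\phi=2(\sigma_{zz}-\sigma_z^2)$, and let $K(\phi(z))=-e^{-2\sigma(z)}\Delta\sigma(z)$ be the Gaussian curvature of the surface $\Sigma=\phi(\mathbb D)$ at $\phi(z)$. Let $d_\Sigma$ denote the intrinsic distance on $\Sigma$, i.e. $d_\Sigma(P,Q)$ is the infimum of the Euclidean lengths of the curves $\phi\circ\gamma$, $\gamma:[0,1]\to\mathbb D$ continuous, that join $P$ to $Q$. **Theorem.** Let $p$ be a Nehari function that is nondecreasing on $[0,1)$, and let $\phi:\mathbb D\to\mathbb C^n$ be holomorphic with $\phi'\ne0$ everywhere, $|\phi'(0)|=1$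 and $$|\mathcal S\phi(z)|+\tfrac34|\phi'(z)|^2|K(\phi(z))|\le 2p(|z|),\qquad z\in\mathbb D.$$ Let $U$ be the solution on $(-1,1)$ of $U''-pU=0$, $U(0)=1$, $U'(0)=0$, and let $\Psi(x)=\int_0^xU(t)^{-2}\,dt$ for $0\le x\le 1$. Then for every $0\le r<1$ the minimum of $d_\Sigma(\phi(z),\phi(0))$ over $|z|=r$ is attained and $$\min_{|z|=r}d_\Sigma(\phi(z),\phi(0))\ \ge\ \frac{2\Psi(r)}{2+|\phi''(0)|\Psi(r)}.$$ In particular $\Sigma$ contains a metric disk of radius $$R=\frac{2\Psi(1)}{2+|\phi''(0)|\Psi(1)}$$ centered at $\phi(0)$, in the sense that for every $0\le\rho<R$ the closed metric disk $\{P\in\Sigma: d_\Sigma(P,\phi(0))\le\rho\}$ is compact in the surface $\Sigma$ (equivalently, its preimage under $\phi$ is a compact subset of $\mathbb D$). -/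

import Mathlib

open Set Metric

open scoped ENNReal

noncomputable section

/-- `u` is a (twice differentiable) solution on `(-1,1)` of the linear equation `u'' = q u`. -/
def SolvesLinearODE (q u : ℝ → ℝ) : Prop :=
  ∀ x ∈ Ioo (-1 : ℝ) 1,
    HasDerivAt u (deriv u x) x ∧ HasDerivAt (deriv u) (q x * u x) x

/-- Nehari functions on `(-1,1)`. -/
structure IsNehariFunction (p : ℝ → ℝ) : Prop where
  pos : ∀ x ∈ Ioo (-1 : ℝ) 1, 0 < p x
  even : ∀ x ∈ Ioo (-1 : ℝ) 1, p (-x) = p x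
  cont : ContinuousOn p (Ioo (-1) 1)
  anti : AntitoneOn (fun x => (1 - x ^ 2) ^ 2 * p x) (Ico 0 1)
  /-- A solution of `u'' + p u = 0` with two distinct zeros in `(-1,1)` is trivial. -/
  disconj : ∀ u : ℝ → ℝ, SolvesLinearODE (fun x => -p x) u →
    ∀ x ∈ Ioo (-1 : ℝ) 1, ∀ y ∈ Ioo (-1 : ℝ) 1, x ≠ y → u x = 0 → u y = 0 →
      ∀ t ∈ Ioo (-1 : ℝ) 1, u t = 0

/-- The operator `∂/∂z = (1/2) (∂/∂x - i ∂/∂y)`. -/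
def wirtingerDz (g : ℂ → ℂ) (z : ℂ) : ℂ :=
  (1 / 2) * (fderiv ℝ g z 1 - Complex.I * fderiv ℝ g z Complex.I)

/-- `σ = (1/2) log (|f₁'|² + ⋯ + |fₙ'|²)` for `φ = (f₁, …, fₙ)`. -/
def confFactor {n : ℕ} (φ : ℂ → EuclideanSpace ℂ (Fin n)) (z : ℂ) : ℝ :=
  (1 / 2) * Real.log (∑ k, ‖deriv (fun w => φ w k) z‖ ^ 2)

/-- The Schwarzian derivative `S φ = 2 (σ_zz - σ_z²)`. -/
def holSchwarzian {n : ℕ} (φ : ℂ → EuclideanSpace ℂ (Fin n)) (z : ℂ) : ℂ :=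
  2 * (wirtingerDz (wirtingerDz (fun w => (confFactor φ w : ℂ))) z -
    wirtingerDz (fun w => (confFactor φ w : ℂ)) z ^ 2)

/-- The Gaussian curvature `K(φ(z)) = - e^{-2σ(z)} Δσ(z)` of `φ(𝔻)` at `φ(z)`. -/
def gaussCurvature {n : ℕ} (φ : ℂ → EuclideanSpace ℂ (Fin n)) (z : ℂ) : ℝ :=
  -Real.exp (-2 * confFactor φ z) * Laplacian.laplacian (confFactor φ) z

/-- Distance on the surface `Σ = φ(𝔻)` between two points `P`, `Q` of `Σ`: the infimum of the
Euclidean lengths of the curves `φ ∘ γ` on `Σ` that join `P` to `Q`. -/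
def surfaceEDist {n : ℕ} (φ : ℂ → EuclideanSpace ℂ (Fin n)) (P Q : EuclideanSpace ℂ (Fin n)) :
    ℝ≥0∞ :=
  ⨅ (γ : ℝ → ℂ) (_ : ContinuousOn γ (Icc 0 1)) (_ : MapsTo γ (Icc 0 1) (ball 0 1))
    (_ : φ (γ 0) = P) (_ : φ (γ 1) = Q), eVariationOn (φ ∘ γ) (Icc 0 1)

/-- `Σ = φ(𝔻)` contains the metric disk of radius `R` about `φ(a)`: for every `ρ < R` the closed
metric disk of radius `ρ` about `φ(a)` is compact in `Σ` (so it does not reach the edge of `Σ`).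
The disk is read off in the global coordinate `z ∈ 𝔻` of `Σ`. -/
def ContainsMetricDisk {n : ℕ} (φ : ℂ → EuclideanSpace ℂ (Fin n)) (a : ℂ) (R : ℝ) : Prop :=
  ∀ ρ : ℝ, 0 ≤ ρ → ρ < R →
    IsCompact {z : ℂ | z ∈ ball (0 : ℂ) 1 ∧ surfaceEDist φ (φ z) (φ a) ≤ ENNReal.ofReal ρ}

/-- `Ψ(x) = ∫₀ˣ U(t)⁻² dt`. -/
def extremalPsi (U : ℝ → ℝ) (x : ℝ) : ℝ :=
  ∫ t in (0 : ℝ)..x, (U t ^ 2)⁻¹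

end

/-! Write A, B, D for the first three derivatives of φ. The Schwarzian and the curvature have closed
forms in A, B, D (`schwarzianForm`, `curvatureForm`), and the hypothesis becomes |S| + (3/2)κ ≤ 2p,
where κ is the squared length of the part of B orthogonal to A, divided by |A|². This bound is used
twice.

Injectivity. A hyperbolic geodesic is the image of (-1,1) under a Möbius map, so S and κ only pick
up the factor |T'|² along it, and the monotonicity of (1-x²)²p turns the bound at T(x) into the
bound at x. Along the geodesic, Re S + (3/2)κ is exactly the Schwarzian of a real curve. If that
curve returned to its starting point, an inversion about this point and a Sturm comparison would
contradict the disconjugacy of u'' + pu = 0 (`IsNehariFunction.injOn_curve`,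
`IsNehariFunction.injOn_ball`). Hence curves on Σ from φ(z) to φ(0) come from curves in the disk
from z to 0.

Distortion. Along a radius, the complex function h with h'/h = -⟨A,B⟩/(2|A|²) and h(0) = 1 satisfies
|A| = |h|⁻² and h'' = -(S + κ)h/2, so |h''| ≤ p|h|. Comparison with U'' = pU bounds |h| from above,
so |φ'(z)| ≥ Λ'(|z|) with Λ = 2Ψ/(2 + |φ''(0)|Ψ) (`SolvesLinearODE.curve_distortion`,
`IsNehariFunction.norm_deriv_ge`).

Summing this bound along an arbitrary continuous curve gives d_Σ(φ(z), φ(0)) ≥ Λ(|z|)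
(`edist_le_eVariationOn_of_norm_deriv_ge`). Lower semicontinuity of the distance yields both the
attained minimum and the closedness of metric disks; continuity of Λ up to 1 confines these disks to
a compact part of the disk. -/

/-! ### Global solvability of u'' = qu on (-1,1) -/

/-- A linear field is unbounded, so Picard–Lindelöf on the whole interval is applied to the field
with its coordinates truncated at a level R. Grönwall's bound for the truncated solution stays below
R, so the truncation is never felt. -/
theorem exists_linear_system_solution_Icc (q : ℝ → ℝ) {b a : ℝ} (ha : a ∈ Icc (-b) b)
    (hq : ContinuousOn q (Icc (-b) b)) (x₀ : ℝ × ℝ) :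
    ∃ F : ℝ → ℝ × ℝ, F a = x₀ ∧
      ∀ t ∈ Icc (-b) b, HasDerivWithinAt F ((F t).2, q t * (F t).1) (Icc (-b) b) t := by
  obtain ⟨M₀, hM₀⟩ := isCompact_Icc.exists_bound_of_continuousOn hq
  -- The floor 1 is needed because the first component of the field has Lipschitz constant 1.
  set M : NNReal := Real.toNNReal (max M₀ 1) with hMdef
  have hMc : (M : ℝ) = max M₀ 1 := Real.coe_toNNReal _ (le_trans zero_le_one (le_max_right _ _))
  have hM1 : (1 : ℝ) ≤ M := hMc ▸ le_max_right _ _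
  have hMq : ∀ t ∈ Icc (-b) b, |q t| ≤ M := fun t ht =>
    (hM₀ t ht).trans (hMc ▸ le_max_left _ _)
  have hb0 : 0 ≤ b := by have := ha.1.trans ha.2; linarith
  set R : NNReal := Real.toNNReal (‖x₀‖ * Real.exp (M * (2 * b)) + 1) with hRdef
  have hRc : (R : ℝ) = ‖x₀‖ * Real.exp (M * (2 * b)) + 1 := Real.coe_toNNReal _ (by positivity)
  have hR0 : (0 : ℝ) ≤ R := R.2
  set cl : ℝ → ℝ := fun c => max (-R) (min R c) with hcl
  have cl_lip : ∀ c d, |cl c - cl d| ≤ |c - d| := by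
    intro c d
    refine (abs_max_sub_max_le_max _ _ _ _).trans ?_
    simp only [sub_self, abs_zero]
    refine max_le (abs_nonneg _) ((abs_min_sub_min_le_max _ _ _ _).trans ?_)
    simp
  have cl_zero : cl 0 = 0 := by simp [hcl]
  have cl_le : ∀ c, |cl c| ≤ |c| := fun c => by simpa [cl_zero] using cl_lip c 0
  have cl_bd : ∀ c, |cl c| ≤ R := fun c => by
    rw [abs_le]
    exact ⟨le_max_left _ _, max_le (by linarith) (min_le_left _ _)⟩
  have cl_eq : ∀ c : ℝ, |c| ≤ R → cl c = c := fun c hc => by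
    rw [abs_le] at hc
    simp [hcl, min_eq_right hc.2, max_eq_right hc.1]
  let f : ℝ → ℝ × ℝ → ℝ × ℝ := fun t x => (cl x.2, q t * cl x.1)
  have fle : ∀ t ∈ Icc (-b) b, ∀ x, ‖f t x‖ ≤ M * ‖x‖ := by
    intro t ht x
    simp only [f, Prod.norm_def, Real.norm_eq_abs, abs_mul]
    refine max_le ?_ ?_
    · calc |cl x.2| ≤ |x.2| := cl_le _
        _ ≤ max |x.1| |x.2| := le_max_right _ _
        _ ≤ M * max |x.1| |x.2| := le_mul_of_one_le_left (by positivity) hM1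
    · exact mul_le_mul (hMq t ht) ((cl_le _).trans (le_max_left _ _)) (abs_nonneg _) M.2
  -- The truncated field is bounded by M R, so a ball of radius M R · 2b leaves room for the whole
  -- interval.
  have hPL : IsPicardLindelof f (tmin := -b) (tmax := b) ⟨a, ha⟩ x₀
      (M * R * Real.toNNReal (2 * b)) 0 (M * R) M := by
    refine ⟨fun t ht => ?_, fun x _ => ?_, fun t ht x _ => ?_, ?_⟩
    · refine LipschitzOnWith.of_dist_le_mul fun x _ y _ => ?_
      simp only [f, Prod.dist_eq, Real.dist_eq, ← mul_sub, abs_mul]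
      refine max_le ?_ ?_
      · calc |cl x.2 - cl y.2| ≤ |x.2 - y.2| := cl_lip _ _
          _ ≤ max |x.1 - y.1| |x.2 - y.2| := le_max_right _ _
          _ ≤ M * max |x.1 - y.1| |x.2 - y.2| := le_mul_of_one_le_left (by positivity) hM1
      · exact mul_le_mul (hMq t ht) ((cl_lip _ _).trans (le_max_left _ _)) (abs_nonneg _) M.2
    · exact continuousOn_const.prodMk (hq.mul continuousOn_const)
    · simp only [f, Prod.norm_def, Real.norm_eq_abs, abs_mul, NNReal.coe_mul]
      refine max_le ?_ ?_
      · exact (cl_bd _).trans (le_mul_of_one_le_left hR0 hM1)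
      · exact mul_le_mul (hMq t ht) (cl_bd _) (abs_nonneg _) M.2
    · simp only [NNReal.coe_mul, NNReal.coe_zero, sub_zero]
      rw [Real.coe_toNNReal (2 * b) (by linarith)]
      refine mul_le_mul_of_nonneg_left ?_ (by positivity)
      have := ha.1; have := ha.2
      exact max_le (show b - a ≤ 2 * b by linarith) (show a - -b ≤ 2 * b by linarith)
  obtain ⟨F, hF0, hF⟩ := hPL.exists_eq_forall_mem_Icc_hasDerivWithinAt₀
  have hFc : ContinuousOn F (Icc (-b) b) := fun t ht => (hF t ht).continuousWithinAt
  have key : ∀ r ∈ Icc 0 (2 * b), ‖x₀‖ * Real.exp (M * r) ≤ R := by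
    intro r hr
    rw [hRc]
    have : Real.exp (M * r) ≤ Real.exp (M * (2 * b)) :=
      Real.exp_le_exp.2 (mul_le_mul_of_nonneg_left hr.2 M.2)
    nlinarith [norm_nonneg x₀]
  have bound_right : ∀ t ∈ Icc a b, ‖F t‖ ≤ R := by
    intro t ht
    have h := norm_le_gronwallBound_of_norm_deriv_right_le (f := F) (f' := fun t => f t (F t))
      (δ := ‖x₀‖) (K := M) (ε := 0) (a := a) (b := b)
      (hFc.mono (Icc_subset_Icc_left ha.1))
      (fun s hs => ((hF s ⟨ha.1.trans hs.1, hs.2.le⟩).mono_of_mem_nhdsWithin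
        (Filter.mem_of_superset (Ico_mem_nhdsGE hs.2) (fun r hr => ⟨(ha.1.trans hs.1).trans hr.1, hr.2.le⟩))))
      (by simp [hF0])
      (fun s hs => by simpa using fle s ⟨ha.1.trans hs.1, hs.2.le⟩ (F s)) t ht
    rw [gronwallBound_ε0] at h
    exact h.trans (key _ ⟨by linarith [ht.1], by linarith [ht.2, ha.1]⟩)
  -- The same Grönwall estimate after time reversal.
  have bound_left : ∀ t ∈ Icc (-b) a, ‖F t‖ ≤ R := by
    intro t ht
    have hmap : ∀ s, s ∈ Icc (-a) b → -s ∈ Icc (-b) b := fun s hs =>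
      ⟨by linarith [hs.2], by linarith [hs.1, ha.2]⟩
    have h := norm_le_gronwallBound_of_norm_deriv_right_le (f := fun s => F (-s))
      (f' := fun t => -f (-t) (F (-t)))
      (δ := ‖x₀‖) (K := M) (ε := 0) (a := -a) (b := b)
      (hFc.comp continuousOn_neg hmap)
      (fun s hs => by
        have h1 := hF (-s) (hmap s ⟨hs.1, hs.2.le⟩)
        have h2 : HasDerivWithinAt (fun s : ℝ => -s) (-1) (Icc (-a) b) s :=
          (hasDerivAt_neg s).hasDerivWithinAt
        have h3 := h1.scomp s h2 hmap
        rw [neg_one_smul] at h3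
        refine HasDerivWithinAt.mono_of_mem_nhdsWithin (t := Icc (-a) b) h3
          (Filter.mem_of_superset (Ico_mem_nhdsGE hs.2) (fun r hr => ⟨hs.1.trans hr.1, hr.2.le⟩)))
      (by simp [hF0])
      (fun s hs => by simpa using fle (-s) (hmap s ⟨hs.1, hs.2.le⟩) (F (-s)))
      (-t) ⟨by linarith [ht.2], by linarith [ht.1]⟩
    rw [gronwallBound_ε0] at h
    simp only [neg_neg] at h
    exact h.trans (key _ ⟨by linarith [ht.2], by linarith [ht.1, ha.2]⟩)
  have bound : ∀ t ∈ Icc (-b) b, ‖F t‖ ≤ R := fun t ht =>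
    (le_total t a).elim (fun h => bound_left t ⟨ht.1, h⟩) (fun h => bound_right t ⟨h, ht.2⟩)
  refine ⟨F, hF0, fun t ht => ?_⟩
  have hb := bound t ht
  rw [Prod.norm_def] at hb
  have := hF t ht
  simp only [f, cl_eq _ ((le_max_left _ _).trans hb), cl_eq _ ((le_max_right _ _).trans hb)] at this
  exact this

theorem linear_system_solution_unique {q : ℝ → ℝ} {b a : ℝ} (ha : a ∈ Ioo (-b) b)
    (hq : ContinuousOn q (Icc (-b) b)) {F G : ℝ → ℝ × ℝ}
    (hF : ∀ t ∈ Icc (-b) b, HasDerivWithinAt F ((F t).2, q t * (F t).1) (Icc (-b) b) t)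
    (hG : ∀ t ∈ Icc (-b) b, HasDerivWithinAt G ((G t).2, q t * (G t).1) (Icc (-b) b) t)
    (h : F a = G a) : EqOn F G (Icc (-b) b) := by
  obtain ⟨M₀, hM₀⟩ := isCompact_Icc.exists_bound_of_continuousOn hq
  set M : NNReal := Real.toNNReal (max M₀ 1) with hMdef
  have hMc : (M : ℝ) = max M₀ 1 := Real.coe_toNNReal _ (le_trans zero_le_one (le_max_right _ _))
  have hM1 : (1 : ℝ) ≤ M := hMc ▸ le_max_right _ _
  have hMq : ∀ t ∈ Icc (-b) b, |q t| ≤ M := fun t ht =>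
    (hM₀ t ht).trans (hMc ▸ le_max_left _ _)
  refine ODE_solution_unique_of_mem_Icc (v := fun t x => (x.2, q t * x.1)) (s := fun _ => univ)
    (K := M) (t₀ := a) (fun t ht => ?_) ha (fun t ht => (hF t ht).continuousWithinAt)
    (fun t ht => (hF t (Ioo_subset_Icc_self ht)).hasDerivAt (Icc_mem_nhds ht.1 ht.2))
    (fun _ _ => mem_univ _) (fun t ht => (hG t ht).continuousWithinAt)
    (fun t ht => (hG t (Ioo_subset_Icc_self ht)).hasDerivAt (Icc_mem_nhds ht.1 ht.2))
    (fun _ _ => mem_univ _) h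
  refine LipschitzOnWith.of_dist_le_mul fun x _ y _ => ?_
  simp only [Prod.dist_eq, Real.dist_eq, ← mul_sub, abs_mul]
  refine max_le ?_ ?_
  · calc |x.2 - y.2| ≤ max |x.1 - y.1| |x.2 - y.2| := le_max_right _ _
      _ ≤ M * max |x.1 - y.1| |x.2 - y.2| := le_mul_of_one_le_left (by positivity) hM1
  · exact mul_le_mul (hMq t (Ioo_subset_Icc_self ht)) (le_max_left _ _) (abs_nonneg _) M.2

/-- Initial value problems for `u'' = q u` are solvable on the whole interval `(-1,1)`. -/
theorem exists_solvesLinearODE {q : ℝ → ℝ} (hq : ContinuousOn q (Ioo (-1) 1)) {a : ℝ}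
    (ha : a ∈ Ioo (-1 : ℝ) 1) (α β : ℝ) :
    ∃ u, SolvesLinearODE q u ∧ u a = α ∧ deriv u a = β := by
  have sub : ∀ b < 1, Icc (-b) b ⊆ Ioo (-1 : ℝ) 1 := fun b hb t ht =>
    ⟨by linarith [ht.1], by linarith [ht.2]⟩
  have H : ∀ b : ℝ, ∃ F : ℝ → ℝ × ℝ, a ∈ Icc (-b) b → b < 1 → F a = (α, β) ∧
      ∀ t ∈ Icc (-b) b, HasDerivWithinAt F ((F t).2, q t * (F t).1) (Icc (-b) b) t := by
    intro b
    by_cases h : a ∈ Icc (-b) b ∧ b < 1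
    · obtain ⟨F, hF⟩ := exists_linear_system_solution_Icc q h.1 (hq.mono (sub b h.2)) (α, β)
      exact ⟨F, fun _ _ => hF⟩
    · exact ⟨0, fun h1 h2 => absurd ⟨h1, h2⟩ h⟩
  choose F hF using H
  -- Halfway between max(|x|, |a|) and 1: the interval with ends ±bb x contains x and a in its
  -- interior and stays inside (-1,1). The solutions agree on overlaps, and `G` glues them along the
  -- diagonal.
  set bb : ℝ → ℝ := fun x => (1 + max |x| |a|) / 2 with hbb
  have bb_lt : ∀ x ∈ Ioo (-1 : ℝ) 1, bb x < 1 := fun x hx => by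
    have := max_lt (abs_lt.2 hx) (abs_lt.2 ha)
    simp only [hbb]; linarith
  have x_mem : ∀ x ∈ Ioo (-1 : ℝ) 1, x ∈ Ioo (-bb x) (bb x) := fun x hx => by
    have := max_lt (abs_lt.2 hx) (abs_lt.2 ha)
    have h2 := le_max_left |x| |a|
    exact abs_lt.1 (by simp only [hbb]; linarith)
  have a_mem : ∀ x ∈ Ioo (-1 : ℝ) 1, a ∈ Ioo (-bb x) (bb x) := fun x hx => by
    have := max_lt (abs_lt.2 hx) (abs_lt.2 ha)
    have h2 := le_max_right |x| |a|
    exact abs_lt.1 (by simp only [hbb]; linarith)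
  have hFb : ∀ x ∈ Ioo (-1 : ℝ) 1, _ := fun x hx =>
    hF (bb x) (Ioo_subset_Icc_self (a_mem x hx)) (bb_lt x hx)
  have agree : ∀ x ∈ Ioo (-1 : ℝ) 1, ∀ y ∈ Ioo (-1 : ℝ) 1, bb x ≤ bb y →
      EqOn (F (bb x)) (F (bb y)) (Icc (-bb x) (bb x)) := by
    intro x hx y hy hxy
    have hsub : Icc (-bb x) (bb x) ⊆ Icc (-bb y) (bb y) := Icc_subset_Icc (by linarith) hxy
    exact linear_system_solution_unique (a_mem x hx) (hq.mono (sub _ (bb_lt x hx))) (hFb x hx).2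
      (fun t ht => ((hFb y hy).2 t (hsub ht)).mono hsub) ((hFb x hx).1.trans (hFb y hy).1.symm)
  set G : ℝ → ℝ × ℝ := fun x => F (bb x) x with hG
  have loc : ∀ x ∈ Ioo (-1 : ℝ) 1, G =ᶠ[nhds x] F (bb x) := by
    intro x hx
    filter_upwards [Ioo_mem_nhds hx.1 hx.2, Ioo_mem_nhds (x_mem x hx).1 (x_mem x hx).2]
      with y hy hy2
    rcases le_total (bb x) (bb y) with h | h
    · exact (agree x hx y hy h (Ioo_subset_Icc_self hy2)).symm
    · exact agree y hy x hx h (Ioo_subset_Icc_self (x_mem y hy))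
  have hGd : ∀ x ∈ Ioo (-1 : ℝ) 1, HasDerivAt G ((G x).2, q x * (G x).1) x := by
    intro x hx
    have := ((hFb x hx).2 x (Ioo_subset_Icc_self (x_mem x hx))).hasDerivAt
      (Icc_mem_nhds (x_mem x hx).1 (x_mem x hx).2)
    exact this.congr_of_eventuallyEq (loc x hx)
  have h1 : ∀ x ∈ Ioo (-1 : ℝ) 1, HasDerivAt (fun x => (G x).1) (G x).2 x := fun x hx =>
    (hGd x hx).fst
  have h2 : ∀ x ∈ Ioo (-1 : ℝ) 1, HasDerivAt (fun x => (G x).2) (q x * (G x).1) x := fun x hx =>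
    (hGd x hx).snd
  have hGa : G a = (α, β) := (hFb a ha).1
  refine ⟨fun x => (G x).1, fun x hx => ⟨(h1 x hx).differentiableAt.hasDerivAt, ?_⟩, ?_, ?_⟩
  · refine (h2 x hx).congr_of_eventuallyEq ?_
    filter_upwards [Ioo_mem_nhds hx.1 hx.2] with y hy using (h1 y hy).deriv
  · simp [hGa]
  · rw [(h1 a ha).deriv, hGa]

/-! ### Inversion and Sturm comparison for real curves -/

section Curve

variable {E : Type*} [NormedAddCommGroup E] [InnerProductSpace ℝ E]

theorem hasDerivAt_logDeriv_inner {A B : ℝ → E} {D : E} {x : ℝ} (hA : HasDerivAt A (B x) x)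
    (hB : HasDerivAt B D x) (h0 : A x ≠ 0) :
    HasDerivAt (fun t => inner ℝ (A t) (B t) / ‖A t‖ ^ 2)
      ((‖B x‖ ^ 2 + inner ℝ (A x) D) / ‖A x‖ ^ 2 -
        2 * inner ℝ (A x) (B x) ^ 2 / ‖A x‖ ^ 4) x := by
  have h1 := hA.inner ℝ hB
  have h2 := hA.norm_sq
  have hn : ‖A x‖ ≠ 0 := norm_ne_zero_iff.2 h0
  refine (h1.div h2 (pow_ne_zero 2 hn)).congr_deriv ?_
  rw [real_inner_self_eq_norm_sq]
  field_simp
  ring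

/-- The completed square behind the invariance of the curve Schwarzian under inversions. -/
theorem inversion_riccati_nonneg (w A B : E) (hw : w ≠ 0) (hA : A ≠ 0) :
    0 ≤ ‖A‖ ^ 2 / ‖w‖ ^ 2 + inner ℝ w B / ‖w‖ ^ 2 - inner ℝ w A ^ 2 / ‖w‖ ^ 4
      - inner ℝ w A * inner ℝ A B / (‖w‖ ^ 2 * ‖A‖ ^ 2)
      + 1 / 4 * ‖B‖ ^ 2 / ‖A‖ ^ 2 - 1 / 4 * inner ℝ A B ^ 2 / ‖A‖ ^ 4 := by
  have hwn : ‖w‖ ≠ 0 := norm_ne_zero_iff.2 hw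
  have hAn : ‖A‖ ≠ 0 := norm_ne_zero_iff.2 hA
  -- The vector x w + y B - z A is the part of w/‖w‖² + B/(2‖A‖²) orthogonal to A; the claimed
  -- expression is ‖A‖² times its squared norm.
  set x : ℝ := 1 / ‖w‖ ^ 2
  set y : ℝ := 1 / (2 * ‖A‖ ^ 2)
  set z : ℝ := inner ℝ w A / (‖w‖ ^ 2 * ‖A‖ ^ 2) + inner ℝ A B / (2 * ‖A‖ ^ 4)
  have key : ‖x • w + y • B - z • A‖ ^ 2 = x ^ 2 * ‖w‖ ^ 2 + y ^ 2 * ‖B‖ ^ 2 + z ^ 2 * ‖A‖ ^ 2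
      + 2 * x * y * inner ℝ w B - 2 * x * z * inner ℝ w A - 2 * y * z * inner ℝ A B := by
    rw [norm_sub_sq_real, norm_add_sq_real, inner_add_left]
    simp only [real_inner_smul_left, real_inner_smul_right, norm_smul, mul_pow, Real.norm_eq_abs,
      sq_abs, real_inner_comm A B]
    ring
  have : 0 ≤ ‖A‖ ^ 2 * ‖x • w + y • B - z • A‖ ^ 2 := by positivity
  rw [key] at this
  convert this using 1
  simp only [x, y, z]
  field_simp
  ring

/-- A regular curve in a Euclidean space whose Schwarzian is at most `2p`, with `p` a Nehari
function, is injective. -/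
theorem IsNehariFunction.injOn_curve {p : ℝ → ℝ} (hp : IsNehariFunction p) {c A B D : ℝ → E}
    (hc : ∀ x ∈ Ioo (-1 : ℝ) 1, HasDerivAt c (A x) x)
    (hA : ∀ x ∈ Ioo (-1 : ℝ) 1, HasDerivAt A (B x) x)
    (hB : ∀ x ∈ Ioo (-1 : ℝ) 1, HasDerivAt B (D x) x)
    (h0 : ∀ x ∈ Ioo (-1 : ℝ) 1, A x ≠ 0)
    (hS : ∀ x ∈ Ioo (-1 : ℝ) 1, inner ℝ (A x) (D x) / ‖A x‖ ^ 2 + 3 / 2 * ‖B x‖ ^ 2 / ‖A x‖ ^ 2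
      - 3 * inner ℝ (A x) (B x) ^ 2 / ‖A x‖ ^ 4 ≤ 2 * p x) :
    InjOn c (Ioo (-1) 1) := by
  suffices H : ∀ a ∈ Ioo (-1 : ℝ) 1, ∀ b ∈ Ioo (-1 : ℝ) 1, a < b → c a ≠ c b by
    intro a ha b hb hab
    by_contra hne
    rcases lt_or_gt_of_ne hne with h | h
    · exact H a ha b hb h hab
    · exact H b hb a ha h hab.symm
  -- reduce to the first return to the initial point
  suffices H : ∀ a ∈ Ioo (-1 : ℝ) 1, ∀ b ∈ Ioo (-1 : ℝ) 1, a < b → c b = c a →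
      (∀ t ∈ Ioo a b, c t ≠ c a) → False by
    intro a ha b hb hab heq
    -- Nonzero velocity keeps the curve away from c a just after time a, so a first return time
    -- exists and is larger than a.
    have hev : ∀ᶠ t in nhdsWithin a {a}ᶜ, c t ≠ c a := (hc a ha).eventually_ne (h0 a ha)
    have hev2 : ∀ᶠ t in nhdsWithin a (Ioi a), c t ≠ c a :=
      hev.filter_mono (nhdsWithin_mono _ (fun t ht => ne_of_gt ht))
    obtain ⟨e, hae, he⟩ := (mem_nhdsGT_iff_exists_Ioo_subset).1 hev2
    have hcc : ContinuousOn c (Icc a b) := fun t ht =>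
      (hc t ⟨ha.1.trans_le ht.1, ht.2.trans_lt hb.2⟩).continuousAt.continuousWithinAt
    have hae' : a < e := hae
    have hsub : Icc (min e b) b ⊆ Icc a b := Icc_subset_Icc_left (le_min hae'.le hab.le)
    set Z : Set ℝ := Icc (min e b) b ∩ c ⁻¹' {c a} with hZ
    have hZc : IsClosed Z := (hcc.mono hsub).preimage_isClosed_of_isClosed isClosed_Icc
      isClosed_singleton
    have hZn : Z.Nonempty := ⟨b, ⟨min_le_right _ _, le_rfl⟩, heq.symm⟩
    have hZb : BddBelow Z := ⟨min e b, fun t ht => ht.1.1⟩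
    have hm := hZc.csInf_mem hZn hZb
    set b' := sInf Z
    have hab' : a < b' := (lt_min hae' hab).trans_le hm.1.1
    refine H a ha b' ⟨ha.1.trans hab', hm.1.2.trans_lt hb.2⟩ hab' hm.2 fun t ht hta => ?_
    by_cases hte : t < min e b
    · exact he ⟨ht.1, hte.trans_le (min_le_left _ _)⟩ hta
    · exact absurd (csInf_le hZb ⟨⟨not_lt.1 hte, ht.2.le.trans hm.1.2⟩, hta⟩) (not_le.2 ht.2)
  intro a ha b hb hab hcb hne
  have sub1 : Icc a b ⊆ Ioo (-1 : ℝ) 1 := fun t ht => ⟨ha.1.trans_le ht.1, ht.2.trans_lt hb.2⟩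
  -- the comparison solution
  obtain ⟨y, hy, hya, hya'⟩ := exists_solvesLinearODE (q := fun x => -p x) hp.cont.neg ha 0 1
  have hyd : HasDerivAt y 1 a := hya' ▸ (hy a ha).1
  have hyne : ∀ t ∈ Ioc a b, y t ≠ 0 := by
    intro t ht hyt
    have hz := hp.disconj y hy a ha t (sub1 (Ioc_subset_Icc_self ht)) ht.1.ne hya hyt
    have : y =ᶠ[nhds a] fun _ => (0 : ℝ) := by
      filter_upwards [Ioo_mem_nhds ha.1 ha.2] with s hs using hz s hs
    have h1 := this.deriv_eq
    rw [hya'] at h1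
    simp at h1
  have hyc : ContinuousOn y (Icc a b) := fun t ht =>
    (hy t (sub1 ht)).1.continuousAt.continuousWithinAt
  have hypos : ∀ t ∈ Ioc a b, 0 < y t := by
    have hev : ∀ᶠ t in nhdsWithin a (Ioi a), 0 < y t := by
      have h2 := hyd.hasDerivWithinAt (s := Ioi a)
      rw [hasDerivWithinAt_iff_tendsto_slope' (by simp)] at h2
      filter_upwards [h2.eventually (lt_mem_nhds (zero_lt_one' ℝ)), self_mem_nhdsWithin] with t h ht
      rw [slope_def_field, hya, sub_zero] at h
      exact (div_pos_iff_of_pos_right (sub_pos.2 ht)).1 h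
    intro t ht
    by_contra hyt
    obtain ⟨s, hs, hst⟩ := (hev.and (Ioo_mem_nhdsGT ht.1)).exists
    obtain ⟨r, hr, hr0⟩ := intermediate_value_Icc' hst.2.le
      (hyc.mono (Icc_subset_Icc hst.1.le ht.2)) ⟨not_lt.1 hyt, hs.le⟩
    exact hyne r ⟨hst.1.trans_le hr.1, hr.2.trans ht.2⟩ hr0
  set w : ℝ → E := fun t => c t - c a with hw
  have hwd : ∀ t ∈ Icc a b, HasDerivAt w (A t) t := fun t ht => (hc t (sub1 ht)).sub_const _
  have hw0 : ∀ t ∈ Ioo a b, w t ≠ 0 := fun t ht => sub_ne_zero.2 (hne t ht)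
  -- The inverted curve w/‖w‖² has speed ‖A‖/‖w‖² = 1/v. Thus u = √v is its speed to the power -1/2,
  -- and ψ = u'/u satisfies the Riccati inequality ψ' + ψ² ≥ -p, that is, u'' + pu ≥ 0.
  set v : ℝ → ℝ := fun t => ‖w t‖ ^ 2 / Real.sqrt (‖A t‖ ^ 2) with hv
  set u : ℝ → ℝ := fun t => Real.sqrt (v t) with hu
  set ψ : ℝ → ℝ := fun t => inner ℝ (w t) (A t) / ‖w t‖ ^ 2
    - 1 / 2 * (inner ℝ (A t) (B t) / ‖A t‖ ^ 2) with hψ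
  have hAn : ∀ t ∈ Icc a b, ‖A t‖ ≠ 0 := fun t ht => norm_ne_zero_iff.2 (h0 t (sub1 ht))
  have hvd : ∀ t ∈ Icc a b, HasDerivAt v (2 * inner ℝ (w t) (A t) / ‖A t‖
      - ‖w t‖ ^ 2 * inner ℝ (A t) (B t) / ‖A t‖ ^ 3) t := by
    intro t ht
    have hn := hAn t ht
    have h1 := (hwd t ht).norm_sq
    have h2 := (hA t (sub1 ht)).norm_sq.sqrt (pow_ne_zero 2 hn)
    refine (h1.div h2 (by simpa using hn)).congr_deriv ?_
    rw [Real.sqrt_sq (norm_nonneg _)]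
    field_simp
  have hvpos : ∀ t ∈ Ioo a b, 0 < v t := fun t ht => by
    have h1 := norm_pos_iff.2 (hw0 t ht)
    have h2 := norm_pos_iff.2 (h0 t (sub1 (Ioo_subset_Icc_self ht)))
    simp only [hv]; positivity
  have hupos : ∀ t ∈ Ioo a b, 0 < u t := fun t ht => Real.sqrt_pos.2 (hvpos t ht)
  have huc : ∀ t ∈ Icc a b, ContinuousAt u t := fun t ht => (hvd t ht).continuousAt.sqrt
  have hud : ∀ t ∈ Ioo a b, HasDerivAt u (ψ t * u t) t := by
    intro t ht
    have ht' := Ioo_subset_Icc_self ht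
    have h1 := (hvd t ht').sqrt (hvpos t ht).ne'
    convert h1 using 1
    rw [eq_div_iff (by have := hupos t ht; positivity)]
    have h2 : u t * u t = v t := Real.mul_self_sqrt (hvpos t ht).le
    have h3 : v t = ‖w t‖ ^ 2 / ‖A t‖ := by simp only [hv, Real.sqrt_sq (norm_nonneg _)]
    have h4 := hAn t ht'
    have h5 := norm_ne_zero_iff.2 (hw0 t ht)
    calc ψ t * u t * (2 * u t) = 2 * ψ t * (u t * u t) := by ring
      _ = _ := by
        rw [h2, h3]
        simp only [hψ]
        field_simp
  have hψd : ∀ t ∈ Ioo a b, ∃ ψ', HasDerivAt ψ ψ' t ∧ -p t ≤ ψ' + ψ t ^ 2 := by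
    intro t ht
    have ht' := Ioo_subset_Icc_self ht
    have h4 := hAn t ht'
    have h5 := norm_ne_zero_iff.2 (hw0 t ht)
    have h1 := ((hwd t ht').inner ℝ (hA t (sub1 ht'))).div (hwd t ht').norm_sq (pow_ne_zero 2 h5)
    have h2 := hasDerivAt_logDeriv_inner (hA t (sub1 ht')) (hB t (sub1 ht')) (h0 t (sub1 ht'))
    refine ⟨_, h1.sub (h2.const_mul (1 / 2)), ?_⟩
    have h6 := inversion_riccati_nonneg (w t) (A t) (B t) (hw0 t ht) (h0 t (sub1 ht'))
    have h7 := hS t (sub1 ht')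
    rw [real_inner_self_eq_norm_sq]
    have h8 : (((‖A t‖ ^ 2 + inner ℝ (w t) (B t)) * ‖w t‖ ^ 2
          - inner ℝ (w t) (A t) * (2 * inner ℝ (w t) (A t))) / (‖w t‖ ^ 2) ^ 2
          - 1 / 2 * ((‖B t‖ ^ 2 + inner ℝ (A t) (D t)) / ‖A t‖ ^ 2
            - 2 * inner ℝ (A t) (B t) ^ 2 / ‖A t‖ ^ 4)) + ψ t ^ 2
        = (‖A t‖ ^ 2 / ‖w t‖ ^ 2 + inner ℝ (w t) (B t) / ‖w t‖ ^ 2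
          - inner ℝ (w t) (A t) ^ 2 / ‖w t‖ ^ 4
          - inner ℝ (w t) (A t) * inner ℝ (A t) (B t) / (‖w t‖ ^ 2 * ‖A t‖ ^ 2)
          + 1 / 4 * ‖B t‖ ^ 2 / ‖A t‖ ^ 2 - 1 / 4 * inner ℝ (A t) (B t) ^ 2 / ‖A t‖ ^ 4)
          - 1 / 2 * (inner ℝ (A t) (D t) / ‖A t‖ ^ 2 + 3 / 2 * ‖B t‖ ^ 2 / ‖A t‖ ^ 2
            - 3 * inner ℝ (A t) (B t) ^ 2 / ‖A t‖ ^ 4) := by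
      simp only [hψ]
      field_simp
      ring
    have h9 : inner ℝ (w t) (B t) + ‖A t‖ ^ 2 = ‖A t‖ ^ 2 + inner ℝ (w t) (B t) := add_comm _ _
    rw [h9]
    linarith
  -- the Wronskian
  set W : ℝ → ℝ := fun t => ψ t * u t * y t - u t * deriv y t with hW
  have hWd : ∀ t ∈ Ioo a b, ∃ W', HasDerivAt W W' t ∧ 0 ≤ W' := by
    intro t ht
    obtain ⟨ψ', h1, h2⟩ := hψd t ht
    have hyt := hy t (sub1 (Ioo_subset_Icc_self ht))
    refine ⟨_, ((h1.mul (hud t ht)).mul hyt.1).sub ((hud t ht).mul hyt.2), ?_⟩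
    have h3 := hupos t ht
    have h4 := hypos t (Ioo_subset_Ioc_self ht)
    have : 0 ≤ (ψ' + ψ t ^ 2 + p t) * (u t * y t) := mul_nonneg (by linarith) (by positivity)
    simp only [Pi.mul_apply]
    nlinarith [this]
  have hWmono : MonotoneOn W (Ioo a b) := by
    refine monotoneOn_of_deriv_nonneg (convex_Ioo _ _) (fun t ht => ?_) (fun t ht => ?_)
      (fun t ht => ?_)
    · obtain ⟨_, h, _⟩ := hWd t ht
      exact h.continuousAt.continuousWithinAt
    · obtain ⟨_, h, _⟩ := hWd t (interior_subset ht)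
      exact h.differentiableAt.differentiableWithinAt
    · obtain ⟨_, h, h2⟩ := hWd t (interior_subset ht)
      rwa [h.deriv]
  have haI : a ∈ Icc a b := ⟨le_rfl, hab.le⟩
  have hu0 : u a = 0 := by simp [hu, hv, hw]
  -- Although ψ may be singular at a, the term ⟨w,A⟩u/‖w‖² is at most √‖A‖ by Cauchy–Schwarz, while
  -- u and y both vanish at a.
  have hWlim : Filter.Tendsto W (nhdsWithin a (Ioi a)) (nhds 0) := by
    set G : ℝ → ℝ := fun t => Real.sqrt ‖A t‖ * |y t|
      + 1 / 2 * |inner ℝ (A t) (B t) / ‖A t‖ ^ 2| * u t * |y t| + u t * |deriv y t| with hG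
    have hGc : ContinuousAt G a := by
      have c1 := (hA a ha).continuousAt
      have c2 := (hB a ha).continuousAt
      have c3 := (hy a ha).1.continuousAt
      have c4 := (hy a ha).2.continuousAt
      have c5 := huc a haI
      have c6 : ContinuousAt (fun t => inner ℝ (A t) (B t) / ‖A t‖ ^ 2) a :=
        (hasDerivAt_logDeriv_inner (hA a ha) (hB a ha) (h0 a ha)).continuousAt
      exact ((c1.norm.sqrt.mul c3.abs).add (((continuousAt_const.mul c6.abs).mul c5).mul
        c3.abs)).add (c5.mul c4.abs)
    have hG0 : G a = 0 := by simp [hG, hu0, hya]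
    have hGl : Filter.Tendsto G (nhdsWithin a (Ioi a)) (nhds 0) :=
      hG0 ▸ hGc.tendsto.mono_left nhdsWithin_le_nhds
    refine squeeze_zero_norm' ?_ hGl
    filter_upwards [Ioo_mem_nhdsGT hab] with t ht
    have ht' := Ioo_subset_Icc_self ht
    have h4 := hAn t ht'
    have h5 := norm_pos_iff.2 (hw0 t ht)
    have hu1 := hupos t ht
    have h6 : |inner ℝ (w t) (A t) / ‖w t‖ ^ 2 * u t| ≤ Real.sqrt ‖A t‖ := by
      have hA0 : 0 < ‖A t‖ := lt_of_le_of_ne (norm_nonneg _) (Ne.symm h4)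
      have h7 : u t = ‖w t‖ / Real.sqrt ‖A t‖ := by
        simp only [hu, hv, Real.sqrt_sq (norm_nonneg _)]
        rw [Real.sqrt_div (by positivity), Real.sqrt_sq h5.le]
      have h8 : 0 < Real.sqrt ‖A t‖ := Real.sqrt_pos.2 hA0
      rw [h7, abs_mul, abs_div, abs_div, abs_of_pos h5, abs_of_pos h8, abs_of_pos (pow_pos h5 2)]
      have h9 := abs_real_inner_le_norm (w t) (A t)
      have h10 := Real.mul_self_sqrt hA0.le
      rw [div_mul_div_comm, div_le_iff₀ (by positivity)]
      calc |inner ℝ (w t) (A t)| * ‖w t‖ ≤ (‖w t‖ * ‖A t‖) * ‖w t‖ := by gcongr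
        _ = Real.sqrt ‖A t‖ * (‖w t‖ ^ 2 * Real.sqrt ‖A t‖) := by nth_rewrite 1 [← h10]; ring
    have e1 : W t = (inner ℝ (w t) (A t) / ‖w t‖ ^ 2 * u t) * y t
        - (1 / 2 * (inner ℝ (A t) (B t) / ‖A t‖ ^ 2) * u t * y t) - u t * deriv y t := by
      simp only [hW, hψ]; ring
    rw [e1, Real.norm_eq_abs]
    refine (abs_sub _ _).trans (add_le_add ((abs_sub _ _).trans (add_le_add ?_ ?_)) ?_)
    · rw [abs_mul]; gcongr
    · rw [abs_mul, abs_mul, abs_mul, abs_of_pos hu1]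
      norm_num
    · rw [abs_mul, abs_of_pos hu1]
  have hWnn : ∀ t ∈ Ioo a b, 0 ≤ W t := by
    intro t ht
    refine le_of_tendsto hWlim ?_
    filter_upwards [Ioo_mem_nhdsGT ht.1] with s hs
    exact hWmono ⟨hs.1, hs.2.trans ht.2⟩ ht hs.2.le
  set m := (a + b) / 2
  have ham : a < m := by simp only [m]; linarith
  have hmb : m < b := by simp only [m]; linarith
  -- (u/y)' = W/y² ≥ 0, so u/y cannot drop from a positive value at the midpoint to 0 at b, where
  -- the assumed return makes u vanish.
  have hmono : MonotoneOn (fun t => u t / y t) (Icc m b) := by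
    have hd : ∀ t ∈ Ioo m b, HasDerivAt (fun t => u t / y t) (W t / y t ^ 2) t := by
      intro t ht
      have ht' : t ∈ Ioo a b := ⟨ham.trans ht.1, ht.2⟩
      have := (hud t ht').div (hy t (sub1 (Ioo_subset_Icc_self ht'))).1
        (hypos t (Ioo_subset_Ioc_self ht')).ne'
      exact this
    refine monotoneOn_of_deriv_nonneg (convex_Icc _ _) (fun t ht => ?_) (fun t ht => ?_)
      (fun t ht => ?_)
    · have ht' : t ∈ Icc a b := ⟨ham.le.trans ht.1, ht.2⟩
      exact ((huc t ht').div (hy t (sub1 ht')).1.continuousAt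
        (hypos t ⟨ham.trans_le ht.1, ht.2⟩).ne').continuousWithinAt
    · rw [interior_Icc] at ht
      exact (hd t ht).differentiableAt.differentiableWithinAt
    · rw [interior_Icc] at ht
      rw [(hd t ht).deriv]
      have := hWnn t ⟨ham.trans ht.1, ht.2⟩
      positivity
  have h1 : u m / y m ≤ u b / y b := hmono ⟨le_rfl, hmb.le⟩ ⟨hmb.le, le_rfl⟩ hmb.le
  have h2 : u b = 0 := by simp [hu, hv, hw, hcb]
  have h3 := hupos m ⟨ham, hmb⟩
  have h4 := hypos m ⟨ham, hmb.le⟩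
  rw [h2, zero_div] at h1
  exact absurd h1 (not_le.2 (by positivity))

end Curve

/-! ### Schwarzian and curvature as functions of the derivatives -/

section ClosedForms

theorem wirtingerDz_eq_of_hasFDerivAt {g : ℂ → ℂ} {L : ℂ →L[ℝ] ℂ} {z : ℂ}
    (h : HasFDerivAt g L z) : wirtingerDz g z = 1 / 2 * (L 1 - Complex.I * L Complex.I) := by
  rw [wirtingerDz, h.fderiv]

theorem Filter.EventuallyEq.wirtingerDz_eq {f g : ℂ → ℂ} {z : ℂ} (h : f =ᶠ[nhds z] g) :
    wirtingerDz f z = wirtingerDz g z := by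
  rw [wirtingerDz, wirtingerDz, h.fderiv_eq]

variable {E : Type*} [NormedAddCommGroup E] [InnerProductSpace ℂ E]

theorem inner_self_ofReal (x : E) : inner ℂ x x = ((‖x‖ ^ 2 : ℝ) : ℂ) := by
  rw [inner_self_eq_norm_sq_to_K]; simp

theorem hasFDerivAt_half_log_norm_sq {a : ℂ → E} {b : E} {z : ℂ} (ha : HasDerivAt a b z)
    (h0 : a z ≠ 0) :
    ∃ L : ℂ →L[ℝ] ℝ, HasFDerivAt (fun w => 1 / 2 * Real.log (‖a w‖ ^ 2)) L z ∧
      ∀ v, L v = (v * (inner ℂ (a z) b / (‖a z‖ ^ 2 : ℝ))).re := by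
  let _ : InnerProductSpace ℝ E := InnerProductSpace.complexToReal
  have hre : ∀ x y : E, inner ℝ x y = (inner ℂ x y).re := fun _ _ => rfl
  have hn : ‖a z‖ ≠ 0 := norm_ne_zero_iff.2 h0
  have h1 := ha.hasFDerivAt.restrictScalars ℝ
  have h2 := (h1.norm_sq.log (pow_ne_zero 2 hn)).const_mul (1 / 2 : ℝ)
  refine ⟨_, h2, fun v => ?_⟩
  simp only [smul_apply, ContinuousLinearMap.comp_apply, innerSL_apply_apply,
    ContinuousLinearMap.coe_restrictScalars', smul_eq_mul, hre,
    ContinuousLinearMap.toSpanSingleton_apply, inner_smul_right,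
    ← mul_div_assoc, Complex.div_ofReal_re, nsmul_eq_mul]
  norm_num
  field_simp

/-- The inner product is conjugate-linear in its first slot, so the differential has the form v ↦ α
v̄ + β v. The coefficient β gives the Wirtinger derivative and α gives the Laplacian. -/
theorem hasFDerivAt_inner_div_norm_sq {a b : ℂ → E} {d : E} {z : ℂ} (ha : HasDerivAt a (b z) z)
    (hb : HasDerivAt b d z) (h0 : a z ≠ 0) :
    ∃ L : ℂ →L[ℝ] ℂ, HasFDerivAt (fun w => inner ℂ (a w) (b w) / (‖a w‖ ^ 2 : ℝ)) L z ∧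
      ∀ v, L v = (starRingEnd ℂ v * (‖b z‖ ^ 2 : ℝ) + v * inner ℂ (a z) d) / (‖a z‖ ^ 2 : ℝ)
        - inner ℂ (a z) (b z) *
          (v * inner ℂ (a z) (b z) + starRingEnd ℂ (v * inner ℂ (a z) (b z)))
          / (‖a z‖ ^ 2 : ℝ) ^ 2 := by
  have hn : ((‖a z‖ ^ 2 : ℝ) : ℂ) ≠ 0 := by
    simpa using h0
  have h1 := ha.hasFDerivAt.restrictScalars ℝ
  have h2 := hb.hasFDerivAt.restrictScalars ℝ
  have h3 := h1.inner ℂ h2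
  have h4 := h1.inner ℂ h1
  simp only [inner_self_ofReal] at h4
  have h5 := h3.mul ((hasDerivAt_inv hn).hasFDerivAt.restrictScalars ℝ |>.comp z h4)
  refine ⟨_, by simpa only [div_eq_mul_inv] using! h5, fun v => ?_⟩
  simp [fderivInnerCLM_apply, inner_smul_right, inner_smul_left]
  ring

/-- The Schwarzian of a holomorphic curve in terms of its first three derivatives. -/
noncomputable def schwarzianForm (A B D : E) : ℂ :=
  inner ℂ A D / (‖A‖ ^ 2 : ℝ) - 3 / 2 * (inner ℂ A B / (‖A‖ ^ 2 : ℝ)) ^ 2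

/-- The curvature term `-|φ'|² K / 2` of a holomorphic curve in terms of its first two
derivatives. -/
noncomputable def curvatureForm (A B : E) : ℝ :=
  ‖B‖ ^ 2 / ‖A‖ ^ 2 - ‖inner ℂ A B‖ ^ 2 / ‖A‖ ^ 4

/-- Cauchy–Schwarz. -/
theorem curvatureForm_nonneg (A B : E) : 0 ≤ curvatureForm A B := by
  rcases eq_or_ne A 0 with rfl | hA
  · simp [curvatureForm]
  have h := norm_inner_le_norm (𝕜 := ℂ) A B
  have hA' := norm_pos_iff.2 hA
  rw [curvatureForm, sub_nonneg, div_le_div_iff₀ (by positivity) (by positivity)]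
  have h2 : ‖inner ℂ A B‖ ^ 2 ≤ (‖A‖ * ‖B‖) ^ 2 := by gcongr
  calc ‖inner ℂ A B‖ ^ 2 * ‖A‖ ^ 2 ≤ (‖A‖ * ‖B‖) ^ 2 * ‖A‖ ^ 2 := by gcongr
    _ = _ := by ring

variable {Ω : Set ℂ} {a b d : ℂ → E}

theorem wirtingerDz_half_log_norm_sq {z : ℂ} (ha : HasDerivAt a (b z) z) (h0 : a z ≠ 0) :
    wirtingerDz (fun w => ((1 / 2 * Real.log (‖a w‖ ^ 2) : ℝ) : ℂ)) z
      = 1 / 2 * (inner ℂ (a z) (b z) / (‖a z‖ ^ 2 : ℝ)) := by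
  obtain ⟨L, hL, hLv⟩ := hasFDerivAt_half_log_norm_sq ha h0
  have hL' : HasFDerivAt (fun w => ((1 / 2 * Real.log (‖a w‖ ^ 2) : ℝ) : ℂ))
      (Complex.ofRealCLM.comp L) z := Complex.ofRealCLM.hasFDerivAt.comp z hL
  rw [wirtingerDz_eq_of_hasFDerivAt hL']
  simp only [ContinuousLinearMap.comp_apply, Complex.ofRealCLM_apply, hLv]
  generalize inner ℂ (a z) (b z) / ((‖a z‖ ^ 2 : ℝ) : ℂ) = q
  apply Complex.ext <;> simp

/-- In L(1) - i L(i) the antilinear part of the differential cancels and the linear part doubles. -/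
theorem wirtingerDz_inner_div_norm_sq {z : ℂ} (ha : HasDerivAt a (b z) z)
    (hb : HasDerivAt b (d z) z) (h0 : a z ≠ 0) :
    wirtingerDz (fun w => 1 / 2 * (inner ℂ (a w) (b w) / (‖a w‖ ^ 2 : ℝ))) z
      = 1 / 2 * (inner ℂ (a z) (d z) / (‖a z‖ ^ 2 : ℝ)
        - (inner ℂ (a z) (b z) / (‖a z‖ ^ 2 : ℝ)) ^ 2) := by
  obtain ⟨L, hL, hLv⟩ := hasFDerivAt_inner_div_norm_sq ha hb h0
  rw [wirtingerDz_eq_of_hasFDerivAt (hL.const_mul (1 / 2))]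
  simp only [smul_apply, hLv, smul_eq_mul]
  simp only [map_mul, map_one, Complex.conj_I]
  ring_nf
  simp only [Complex.I_sq]
  ring

/-- The second derivative in direction v is Re(v L(v)) = Re(α|v|² + βv²). Adding v = 1 and v = i
removes β and leaves 2α, where α is the curvature form. -/
theorem laplacian_half_log_norm_sq (hΩ : IsOpen Ω) (ha : ∀ z ∈ Ω, HasDerivAt a (b z) z)
    (hb : ∀ z ∈ Ω, HasDerivAt b (d z) z) (h0 : ∀ z ∈ Ω, a z ≠ 0)
    (z : ℂ) (hz : z ∈ Ω) :
    Laplacian.laplacian (fun w => 1 / 2 * Real.log (‖a w‖ ^ 2)) z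
      = 2 * curvatureForm (a z) (b z) := by
  set σ : ℂ → ℝ := fun w => 1 / 2 * Real.log (‖a w‖ ^ 2) with hσ
  choose! M hM hMv using fun w (hw : w ∈ Ω) => hasFDerivAt_half_log_norm_sq (ha w hw) (h0 w hw)
  have hfd : ∀ w ∈ Ω, fderiv ℝ σ w = M w := fun w hw => (hM w hw).fderiv
  obtain ⟨L, hL, hLv⟩ := hasFDerivAt_inner_div_norm_sq (ha z hz) (hb z hz) (h0 z hz)
  have hdir : ∀ v : ℂ, HasFDerivAt (fun w => fderiv ℝ σ w v)
      (Complex.reCLM.comp (v • L)) z := by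
    intro v
    have h1 : HasFDerivAt (fun w => (v * (inner ℂ (a w) (b w) / (‖a w‖ ^ 2 : ℝ))).re)
      (Complex.reCLM.comp (v • L)) z := Complex.reCLM.hasFDerivAt.comp z (hL.const_mul v)
    refine h1.congr_of_eventuallyEq ?_
    filter_upwards [hΩ.mem_nhds hz] with w hw
    rw [hfd w hw, hMv w hw]
  -- The differential of σ is recovered from its values at 1 and i, both known to be differentiable.
  have hdd : DifferentiableAt ℝ (fderiv ℝ σ) z := by
    have hs : fderiv ℝ σ = fun w => (fderiv ℝ σ w 1) • Complex.reCLM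
        + (fderiv ℝ σ w Complex.I) • Complex.imCLM := by
      funext w
      ext x
      have hx : x = x.re • (1 : ℂ) + x.im • Complex.I := by
        simp [Complex.real_smul, Complex.re_add_im]
      conv_lhs => rw [hx, map_add, map_smul, map_smul]
      simp [mul_comm]
    rw [hs]
    exact ((hdir 1).differentiableAt.smul_const _).add
      ((hdir Complex.I).differentiableAt.smul_const _)
  have hsec : ∀ v : ℂ, fderiv ℝ (fderiv ℝ σ) z v v = (v * L v).re := by
    intro v
    have h2 : HasFDerivAt (fun w => fderiv ℝ σ w v) _ z :=
      hdd.hasFDerivAt.clm_apply (hasFDerivAt_const v z)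
    have h3 := congrArg (fun K : ℂ →L[ℝ] ℝ => K v) (h2.unique (hdir v))
    simpa using h3
  rw [InnerProductSpace.laplacian_eq_iteratedFDeriv_complexPlane]
  simp only [iteratedFDeriv_two_apply, Matrix.cons_val_zero, Matrix.cons_val_one]
  rw [hsec, hsec, hLv, hLv, curvatureForm]
  have hn : ‖a z‖ ≠ 0 := norm_ne_zero_iff.2 (h0 z hz)
  rw [← Complex.normSq_eq_norm_sq (inner ℂ (a z) (b z)), Complex.normSq_apply]
  rw [← Complex.add_re]
  have e : (1 : ℂ) * ((starRingEnd ℂ 1 * (‖b z‖ ^ 2 : ℝ) + 1 * inner ℂ (a z) (d z))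
        / (‖a z‖ ^ 2 : ℝ) - inner ℂ (a z) (b z) * (1 * inner ℂ (a z) (b z)
          + starRingEnd ℂ (1 * inner ℂ (a z) (b z))) / (‖a z‖ ^ 2 : ℝ) ^ 2)
      + Complex.I * ((starRingEnd ℂ Complex.I * (‖b z‖ ^ 2 : ℝ)
        + Complex.I * inner ℂ (a z) (d z)) / (‖a z‖ ^ 2 : ℝ)
        - inner ℂ (a z) (b z) * (Complex.I * inner ℂ (a z) (b z)
          + starRingEnd ℂ (Complex.I * inner ℂ (a z) (b z))) / (‖a z‖ ^ 2 : ℝ) ^ 2)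
      = ((2 * (‖b z‖ ^ 2 / ‖a z‖ ^ 2 - ((inner ℂ (a z) (b z)).re * (inner ℂ (a z) (b z)).re
        + (inner ℂ (a z) (b z)).im * (inner ℂ (a z) (b z)).im) / ‖a z‖ ^ 4) : ℝ) : ℂ) := by
    have hq : ((((inner ℂ (a z) (b z)).re * (inner ℂ (a z) (b z)).re
        + (inner ℂ (a z) (b z)).im * (inner ℂ (a z) (b z)).im : ℝ)) : ℂ)
        = inner ℂ (a z) (b z) * starRingEnd ℂ (inner ℂ (a z) (b z)) := by
      rw [Complex.mul_conj, Complex.normSq_apply]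
    have hn' : (‖a z‖ : ℂ) ≠ 0 := by exact_mod_cast hn
    push_cast at hq ⊢
    rw [hq]
    simp only [map_mul, map_one, Complex.conj_I]
    field_simp
    ring_nf
    simp only [Complex.I_sq]
    ring
  rw [e, Complex.ofReal_re]

end ClosedForms

/-! ### The closed forms for φ -/

section HolomorphicCurve

variable {n : ℕ} {φ : ℂ → EuclideanSpace ℂ (Fin n)}

theorem confFactor_eq {z : ℂ} (h : DifferentiableAt ℂ φ z) :
    confFactor φ z = 1 / 2 * Real.log (‖deriv φ z‖ ^ 2) := by
  rw [confFactor, EuclideanSpace.norm_sq_eq]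
  have : ∀ k, deriv (fun w => φ w k) z = deriv φ z k := fun k =>
    ((EuclideanSpace.proj (𝕜 := ℂ) k).hasFDerivAt.comp_hasDerivAt z h.hasDerivAt).deriv
  simp only [this]

variable {Ω : Set ℂ}

theorem holSchwarzian_eq (hΩ : IsOpen Ω) (hφ : DifferentiableOn ℂ φ Ω)
    (h0 : ∀ z ∈ Ω, deriv φ z ≠ 0) {z : ℂ} (hz : z ∈ Ω) :
    holSchwarzian φ z
      = schwarzianForm (deriv φ z) (deriv (deriv φ) z) (deriv (deriv (deriv φ)) z) := by
  have h1 := hφ.deriv hΩ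
  have h2 := h1.deriv hΩ
  have d1 : ∀ w ∈ Ω, HasDerivAt (deriv φ) (deriv (deriv φ) w) w := fun w hw =>
    (h1.differentiableAt (hΩ.mem_nhds hw)).hasDerivAt
  have d2 : ∀ w ∈ Ω, HasDerivAt (deriv (deriv φ)) (deriv (deriv (deriv φ)) w) w := fun w hw =>
    (h2.differentiableAt (hΩ.mem_nhds hw)).hasDerivAt
  have hσ : ∀ w ∈ Ω, (fun w => (confFactor φ w : ℂ)) =ᶠ[nhds w]
      fun w => ((1 / 2 * Real.log (‖deriv φ w‖ ^ 2) : ℝ) : ℂ) := by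
    intro w hw
    filter_upwards [hΩ.mem_nhds hw] with v hv
    rw [confFactor_eq (hφ.differentiableAt (hΩ.mem_nhds hv))]
  have e1 : ∀ w ∈ Ω, wirtingerDz (fun w => (confFactor φ w : ℂ)) w
      = 1 / 2 * (inner ℂ (deriv φ w) (deriv (deriv φ) w) / (‖deriv φ w‖ ^ 2 : ℝ)) := fun w hw =>
    (hσ w hw).wirtingerDz_eq.trans (wirtingerDz_half_log_norm_sq (d1 w hw) (h0 w hw))
  have e2 : wirtingerDz (fun w => (confFactor φ w : ℂ)) =ᶠ[nhds z]
      fun w => 1 / 2 * (inner ℂ (deriv φ w) (deriv (deriv φ) w) / (‖deriv φ w‖ ^ 2 : ℝ)) := by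
    filter_upwards [hΩ.mem_nhds hz] with w hw using e1 w hw
  rw [holSchwarzian, e2.wirtingerDz_eq, e1 z hz,
    wirtingerDz_inner_div_norm_sq (d1 z hz) (d2 z hz) (h0 z hz), schwarzianForm]
  ring

theorem norm_sq_mul_abs_gaussCurvature (hΩ : IsOpen Ω) (hφ : DifferentiableOn ℂ φ Ω)
    (h0 : ∀ z ∈ Ω, deriv φ z ≠ 0) {z : ℂ} (hz : z ∈ Ω) :
    ‖deriv φ z‖ ^ 2 * |gaussCurvature φ z|
      = 2 * curvatureForm (deriv φ z) (deriv (deriv φ) z) := by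
  have h1 := hφ.deriv hΩ
  have h2 := h1.deriv hΩ
  have hσ : confFactor φ =ᶠ[nhds z] fun w => 1 / 2 * Real.log (‖deriv φ w‖ ^ 2) := by
    filter_upwards [hΩ.mem_nhds hz] with v hv
    rw [confFactor_eq (hφ.differentiableAt (hΩ.mem_nhds hv))]
  have hn := norm_pos_iff.2 (h0 z hz)
  rw [gaussCurvature, (InnerProductSpace.laplacian_congr_nhds hσ).eq_of_nhds, hσ.eq_of_nhds,
    laplacian_half_log_norm_sq hΩ
      (fun w hw => (h1.differentiableAt (hΩ.mem_nhds hw)).hasDerivAt)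
      (fun w hw => (h2.differentiableAt (hΩ.mem_nhds hw)).hasDerivAt) h0 z hz,
    abs_mul, abs_neg, abs_of_pos (Real.exp_pos _),
    abs_of_nonneg (mul_nonneg zero_le_two (curvatureForm_nonneg _ _))]
  have : -2 * (1 / 2 * Real.log (‖deriv φ z‖ ^ 2)) = -Real.log (‖deriv φ z‖ ^ 2) := by ring
  rw [this, Real.exp_neg, Real.exp_log (by positivity)]
  field_simp

end HolomorphicCurve

/-! ### Behaviour under Möbius reparametrization -/

section Reparametrization

variable {E : Type*} [NormedAddCommGroup E] [InnerProductSpace ℂ E]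

/-- Pythagoras: the subtracted vector is the projection of B onto the complex line of A. This form
makes it visible that adding multiples of A to B has no effect. -/
theorem curvatureForm_eq_norm_sub {A : E} (hA : A ≠ 0) (B : E) :
    curvatureForm A B = ‖B - (inner ℂ A B / (‖A‖ ^ 2 : ℝ)) • A‖ ^ 2 / ‖A‖ ^ 2 := by
  have hn : ‖A‖ ≠ 0 := norm_ne_zero_iff.2 hA
  rw [@norm_sub_sq ℂ, inner_smul_right, norm_smul, norm_div, ← inner_conj_symm B A,
    div_mul_eq_mul_div, Complex.mul_conj, Complex.normSq_eq_norm_sq, RCLike.re_eq_complex_re,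
    ← Complex.ofReal_div, Complex.ofReal_re, Complex.norm_real, Real.norm_eq_abs,
    abs_of_nonneg (by positivity : 0 ≤ ‖A‖ ^ 2), curvatureForm]
  field_simp
  ring

/-- The chain rule S(φ∘T) = (Sφ∘T) T'² + ST, with t₁, t₂, t₃ the derivatives of T. The relation `h`
says that ST = 0, as for Möbius maps. -/
theorem schwarzianForm_reparam {a b d : E} (ha : a ≠ 0) {t₁ t₂ t₃ : ℂ} (ht : t₁ ≠ 0)
    (h : 2 * t₃ * t₁ = 3 * t₂ ^ 2) :
    schwarzianForm (t₁ • a) (t₁ ^ 2 • b + t₂ • a)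
      (t₁ ^ 3 • d + (3 * t₁ * t₂) • b + t₃ • a) = t₁ ^ 2 * schwarzianForm a b d := by
  have hn : ((‖a‖ : ℝ) : ℂ) ≠ 0 := by exact_mod_cast norm_ne_zero_iff.2 ha
  have hc : starRingEnd ℂ t₁ ≠ 0 := by simpa using ht
  have h1 : ((‖t₁ • a‖ ^ 2 : ℝ) : ℂ) = starRingEnd ℂ t₁ * t₁ * (‖a‖ : ℂ) ^ 2 := by
    rw [norm_smul, mul_pow, Complex.ofReal_mul, ← Complex.normSq_eq_norm_sq,
      Complex.normSq_eq_conj_mul_self]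
    push_cast
    ring
  have h2 := inner_self_ofReal a
  have h3 : t₃ = 3 * t₂ ^ 2 / (2 * t₁) := by
    rw [eq_div_iff (by simpa using ht)]; linear_combination h
  simp only [schwarzianForm, h1, inner_add_right, inner_smul_left, inner_smul_right, h2, h3]
  push_cast
  field_simp
  ring

/-- The term t₂ a is tangential, so the orthogonal part of the second derivative is just multiplied
by t₁². -/
theorem curvatureForm_reparam {a b : E} (ha : a ≠ 0) {t₁ t₂ : ℂ} (ht : t₁ ≠ 0) :
    curvatureForm (t₁ • a) (t₁ ^ 2 • b + t₂ • a) = ‖t₁‖ ^ 2 * curvatureForm a b := by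
  have hn : ((‖a‖ : ℝ) : ℂ) ≠ 0 := by exact_mod_cast norm_ne_zero_iff.2 ha
  have hn' : ‖a‖ ≠ 0 := norm_ne_zero_iff.2 ha
  have ht' : ‖t₁‖ ≠ 0 := norm_ne_zero_iff.2 ht
  have hc : starRingEnd ℂ t₁ ≠ 0 := by simpa using ht
  have h1 : ((‖t₁ • a‖ ^ 2 : ℝ) : ℂ) = starRingEnd ℂ t₁ * t₁ * (‖a‖ : ℂ) ^ 2 := by
    rw [norm_smul, mul_pow, Complex.ofReal_mul, ← Complex.normSq_eq_norm_sq,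
      Complex.normSq_eq_conj_mul_self]
    push_cast
    ring
  have h2 := inner_self_ofReal a
  rw [curvatureForm_eq_norm_sub ha, curvatureForm_eq_norm_sub (smul_ne_zero ht ha)]
  have key : t₁ ^ 2 • b + t₂ • a
      - (inner ℂ (t₁ • a) (t₁ ^ 2 • b + t₂ • a) / (‖t₁ • a‖ ^ 2 : ℝ)) • t₁ • a
      = t₁ ^ 2 • (b - (inner ℂ a b / (‖a‖ ^ 2 : ℝ)) • a) := by
    have : inner ℂ (t₁ • a) (t₁ ^ 2 • b + t₂ • a) / ((‖t₁ • a‖ ^ 2 : ℝ) : ℂ) * t₁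
        = t₁ ^ 2 * (inner ℂ a b / (‖a‖ ^ 2 : ℝ)) + t₂ := by
      simp only [h1, inner_add_right, inner_smul_left, inner_smul_right, h2]
      push_cast
      field_simp
    rw [smul_smul, this]
    module
  rw [key, norm_smul, norm_smul, norm_pow]
  field_simp

end Reparametrization

/-! ### Hyperbolic geodesics of the disk -/

section Geodesics

/-- The hyperbolic geodesic of the unit disk whose point closest to the origin is `ωρi`. -/
noncomputable def hypGeodesic (ω : ℂ) (ρ x : ℝ) : ℂ :=
  ω * (x + Complex.I * ρ) / (1 - Complex.I * ρ * x)

variable {ω : ℂ} {ρ : ℝ}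

theorem one_sub_I_mul_ne_zero (ρ x : ℝ) : (1 - Complex.I * ρ * x : ℂ) ≠ 0 := by
  intro h
  have := congrArg Complex.re h
  simp at this

theorem normSq_one_sub_I_mul (ρ x : ℝ) : ‖(1 - Complex.I * ρ * x : ℂ)‖ ^ 2 = 1 + ρ ^ 2 * x ^ 2 := by
  rw [← Complex.normSq_eq_norm_sq, Complex.normSq_apply]
  simp
  ring

theorem norm_sq_hypGeodesic (hω : ‖ω‖ = 1) (x : ℝ) :
    ‖hypGeodesic ω ρ x‖ ^ 2 = (x ^ 2 + ρ ^ 2) / (1 + ρ ^ 2 * x ^ 2) := by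
  rw [hypGeodesic, norm_div, norm_mul, hω, one_mul, div_pow, normSq_one_sub_I_mul]
  congr 1
  rw [← Complex.normSq_eq_norm_sq, Complex.normSq_apply]
  simp
  ring

/-- Invariance of the hyperbolic metric: the fraction in front of 1 - x² is |T'(x)| for T =
`hypGeodesic ω ρ` when ρ² < 1. -/
theorem one_sub_norm_sq_hypGeodesic (hω : ‖ω‖ = 1) (x : ℝ) :
    1 - ‖hypGeodesic ω ρ x‖ ^ 2 = (1 - ρ ^ 2) / (1 + ρ ^ 2 * x ^ 2) * (1 - x ^ 2) := by
  have : 1 + ρ ^ 2 * x ^ 2 ≠ 0 := by positivity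
  rw [norm_sq_hypGeodesic hω]
  field_simp
  ring

theorem hypGeodesic_mem_ball (hω : ‖ω‖ = 1) (hρ : ρ ^ 2 < 1) {x : ℝ} (hx : x ∈ Ioo (-1 : ℝ) 1) :
    hypGeodesic ω ρ x ∈ ball (0 : ℂ) 1 := by
  have h := one_sub_norm_sq_hypGeodesic (ρ := ρ) hω x
  have hx2 : 0 < 1 - x ^ 2 := by nlinarith [hx.1, hx.2]
  have h2 : 0 < (1 - ρ ^ 2) / (1 + ρ ^ 2 * x ^ 2) * (1 - x ^ 2) :=
    mul_pos (div_pos (by linarith) (by positivity)) hx2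
  rw [mem_ball_zero_iff]
  nlinarith [norm_nonneg (hypGeodesic ω ρ x)]

theorem abs_le_norm_hypGeodesic (hω : ‖ω‖ = 1) {x : ℝ}
    (hx : x ∈ Ioo (-1 : ℝ) 1) : |x| ≤ ‖hypGeodesic ω ρ x‖ := by
  refine abs_le_of_sq_le_sq' ?_ (norm_nonneg _) |> abs_le.2
  have hx2 : 0 < 1 - x ^ 2 := by nlinarith [hx.1, hx.2]
  rw [norm_sq_hypGeodesic hω, le_div_iff₀ (by positivity)]
  nlinarith [mul_nonneg (sq_nonneg ρ) (by nlinarith [sq_nonneg x] : 0 ≤ 1 - x ^ 2 * x ^ 2)]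

/-- The derivatives of `hypGeodesic` are constant multiples of powers of `(1 - iρx)⁻¹`. -/
theorem hasDerivAt_const_div_one_sub_pow (K : ℂ) (ρ x : ℝ) (k : ℕ) :
    HasDerivAt (fun x : ℝ => K / (1 - Complex.I * ρ * x) ^ k)
      (k * Complex.I * ρ * K / (1 - Complex.I * ρ * x) ^ (k + 1)) x := by
  have hne := one_sub_I_mul_ne_zero ρ x
  have h1 : HasDerivAt (fun x : ℝ => (1 - Complex.I * ρ * x : ℂ)) (-(Complex.I * ρ)) x := by
    simpa using ((Complex.ofRealCLM.hasDerivAt (x := x)).const_mul (Complex.I * ρ)).const_sub 1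
  have h2 := (hasDerivAt_const x K).div (h1.pow k) (pow_ne_zero k hne)
  refine h2.congr_deriv ?_
  rcases k with _ | k
  · simp
  · simp only [Nat.add_sub_cancel, Pi.pow_apply]
    field_simp
    ring

theorem hasDerivAt_hypGeodesic (ω : ℂ) (ρ x : ℝ) :
    HasDerivAt (hypGeodesic ω ρ)
      (ω * (1 - ρ ^ 2) / (1 - Complex.I * ρ * x) ^ 2) x := by
  have hne := one_sub_I_mul_ne_zero ρ x
  have h1 : HasDerivAt (fun x : ℝ => (1 - Complex.I * ρ * x : ℂ)) (-(Complex.I * ρ)) x := by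
    simpa using ((Complex.ofRealCLM.hasDerivAt (x := x)).const_mul (Complex.I * ρ)).const_sub 1
  have h2 : HasDerivAt (fun x : ℝ => ω * (x + Complex.I * ρ : ℂ)) (ω * 1) x := by
    simpa using ((Complex.ofRealCLM.hasDerivAt (x := x)).add_const (Complex.I * ρ)).const_mul ω
  refine (h2.div h1 hne).congr_deriv ?_
  congr 1
  linear_combination ω * ρ ^ 2 * Complex.I_sq

/-- Any two points of the disk lie on one of the geodesics `hypGeodesic ω ρ`. -/
theorem exists_hypGeodesic {z₁ z₂ : ℂ} (h₁ : z₁ ∈ ball (0 : ℂ) 1) (h₂ : z₂ ∈ ball (0 : ℂ) 1)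
    (hne : z₁ ≠ z₂) :
    ∃ (ω : ℂ) (ρ : ℝ), ‖ω‖ = 1 ∧ ρ ^ 2 < 1 ∧
      (∃ x ∈ Ioo (-1 : ℝ) 1, hypGeodesic ω ρ x = z₁) ∧
      ∃ x ∈ Ioo (-1 : ℝ) 1, hypGeodesic ω ρ x = z₂ := by
  rw [mem_ball_zero_iff] at h₁ h₂
  -- Up to a factor 2 this is the passage to the Klein model, where geodesics are chords. The unit
  -- number ω will be the direction of the chord through m z₁ and m z₂, and k its distance from the
  -- origin.
  set m : ℂ → ℂ := fun z => z / ((1 + ‖z‖ ^ 2 : ℝ) : ℂ) with hm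
  have hnm : ∀ z, ‖m z‖ = ‖z‖ / (1 + ‖z‖ ^ 2) := fun z => by
    simp only [hm]
    rw [norm_div, Complex.norm_real, Real.norm_eq_abs, abs_of_pos (by positivity)]
  have hmne : m z₂ - m z₁ ≠ 0 := by
    intro h
    have h' : m z₂ = m z₁ := sub_eq_zero.1 h
    have h3 := congrArg norm h'
    rw [hnm, hnm, div_eq_div_iff (by positivity) (by positivity)] at h3
    have h4 : (‖z₂‖ - ‖z₁‖) * (1 - ‖z₁‖ * ‖z₂‖) = 0 := by linear_combination h3
    have h5 : 1 - ‖z₁‖ * ‖z₂‖ ≠ 0 := by nlinarith [norm_nonneg z₁, norm_nonneg z₂]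
    have h6 : ‖z₂‖ = ‖z₁‖ := by
      rcases mul_eq_zero.1 h4 with h | h
      · linarith
      · exact absurd h h5
    simp only [hm] at h'
    rw [h6] at h'
    have h7 : ((1 + ‖z₁‖ ^ 2 : ℝ) : ℂ) ≠ 0 := by
      exact_mod_cast (by positivity : (1 + ‖z₁‖ ^ 2 : ℝ) ≠ 0)
    exact hne ((div_left_inj' h7).1 h').symm
  set ω₀ : ℂ := (m z₂ - m z₁) / (‖m z₂ - m z₁‖ : ℝ) with hω₀
  have hnz : ((‖m z₂ - m z₁‖ : ℝ) : ℂ) ≠ 0 := by exact_mod_cast norm_ne_zero_iff.2 hmne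
  have hω₀n : ‖ω₀‖ = 1 := by
    rw [hω₀, norm_div, Complex.norm_real, norm_norm, div_self (norm_ne_zero_iff.2 hmne)]
  have him₀ : (starRingEnd ℂ ω₀ * m z₁).im = (starRingEnd ℂ ω₀ * m z₂).im := by
    have : starRingEnd ℂ ω₀ * m z₂ - starRingEnd ℂ ω₀ * m z₁ = (‖m z₂ - m z₁‖ : ℝ) := by
      rw [← mul_sub, hω₀, map_div₀, Complex.conj_ofReal, div_mul_eq_mul_div, mul_comm,
        Complex.mul_conj, Complex.normSq_eq_norm_sq]
      push_cast
      field_simp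
    have h2 := congrArg Complex.im this
    rw [Complex.sub_im, Complex.ofReal_im] at h2
    linarith
  -- The sign of ω is chosen so that k, and with it ρ, is nonnegative.
  obtain ⟨ω, hω, him, hk0⟩ : ∃ ω : ℂ, ‖ω‖ = 1 ∧
      (starRingEnd ℂ ω * m z₁).im = (starRingEnd ℂ ω * m z₂).im ∧
      0 ≤ (starRingEnd ℂ ω * m z₁).im := by
    rcases le_total 0 (starRingEnd ℂ ω₀ * m z₁).im with h | h
    · exact ⟨ω₀, hω₀n, him₀, h⟩
    · refine ⟨-ω₀, by rwa [norm_neg], ?_, ?_⟩ <;> simp only [map_neg, neg_mul, Complex.neg_im]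
      · rw [him₀]
      · linarith
  set k := (starRingEnd ℂ ω * m z₁).im with hk
  have hk2 : k < 1 / 2 := by
    calc k ≤ ‖starRingEnd ℂ ω * m z₁‖ := (le_abs_self _).trans (Complex.abs_im_le_norm _)
      _ = ‖z₁‖ / (1 + ‖z₁‖ ^ 2) := by rw [norm_mul, RCLike.norm_conj, hω, one_mul, hnm]
      _ < 1 / 2 := by
        rw [div_lt_div_iff₀ (by positivity) (by positivity)]
        nlinarith [sq_pos_of_pos (sub_pos.2 h₁)]
  set q := Real.sqrt (1 - 4 * k ^ 2) with hq
  have hq2 : q ^ 2 = 1 - 4 * k ^ 2 := Real.sq_sqrt (by nlinarith)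
  have hq0 : 0 ≤ q := Real.sqrt_nonneg _
  -- The root in [0,1) of ρ = k(1 + ρ²), which locates the point of the geodesic nearest to the
  -- origin.
  set ρ := 2 * k / (1 + q) with hρ
  have hρ0 : 0 ≤ ρ := by positivity
  have hρ1 : ρ < 1 := by rw [hρ, div_lt_one (by positivity)]; linarith
  have hρk : ρ = k * (1 + ρ ^ 2) := by
    rw [hρ]
    field_simp
    linear_combination -k * hq2
  have hρ2 : ρ ^ 2 < 1 := by nlinarith
  have main : ∀ z : ℂ, ‖z‖ < 1 → (starRingEnd ℂ ω * m z).im = k →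
      ∃ x ∈ Ioo (-1 : ℝ) 1, hypGeodesic ω ρ x = z := by
    intro z hz hzk
    set w := starRingEnd ℂ ω * z with hw
    have hωω : ω * starRingEnd ℂ ω = 1 := by
      rw [Complex.mul_conj, Complex.normSq_eq_norm_sq, hω]; simp
    have hwz : ω * w = z := by rw [hw, ← mul_assoc, hωω, one_mul]
    have hwn : ‖w‖ = ‖z‖ := by rw [hw, norm_mul, RCLike.norm_conj, hω, one_mul]
    have hwim : w.im = k * (1 + ‖w‖ ^ 2) := by
      rw [hwn, ← hzk]
      simp only [hm]
      rw [← mul_div_assoc, Complex.div_ofReal_im]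
      have : 1 + ‖z‖ ^ 2 ≠ 0 := by positivity
      field_simp
      rfl
    have hden : (1 + Complex.I * ρ * w) ≠ 0 := by
      intro h
      have h2 : Complex.I * ρ * w = -1 := by linear_combination h
      have h3 := congrArg norm h2
      rw [norm_mul, norm_mul, Complex.norm_I, Complex.norm_real, Real.norm_eq_abs,
        abs_of_nonneg hρ0, hwn, norm_neg, norm_one, one_mul] at h3
      nlinarith [norm_nonneg z]
    -- The inverse Möbius map; its value is real because z lies on the chord.
    set ξ : ℂ := (w - Complex.I * ρ) / (1 + Complex.I * ρ * w) with hξ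
    have hξim : ξ.im = 0 := by
      have h1 : (w - Complex.I * ρ).im * (1 + Complex.I * ρ * w).re
          - (w - Complex.I * ρ).re * (1 + Complex.I * ρ * w).im = 0 := by
        have h4 : ‖w‖ ^ 2 = w.re * w.re + w.im * w.im := by
          rw [← Complex.normSq_eq_norm_sq, Complex.normSq_apply]
        rw [h4] at hwim
        simp
        linear_combination (1 + ρ ^ 2) * hwim - (1 + (w.re * w.re + w.im * w.im)) * hρk
      rw [hξ, Complex.div_im, ← sub_div, h1, zero_div]
    have hξx : ((ξ.re : ℝ) : ℂ) = ξ := by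
      apply Complex.ext <;> simp [hξim]
    have hT : hypGeodesic ω ρ ξ.re = z := by
      have hd := one_sub_I_mul_ne_zero ρ ξ.re
      rw [hypGeodesic, div_eq_iff hd, hξx, ← hwz, mul_assoc]
      congr 1
      have : ξ * (1 + Complex.I * ρ * w) = w - Complex.I * ρ := div_mul_cancel₀ _ hden
      linear_combination this
    refine ⟨ξ.re, ?_, hT⟩
    have h5 := one_sub_norm_sq_hypGeodesic (ρ := ρ) hω ξ.re
    rw [hT] at h5
    have h6 : 0 < 1 - ‖z‖ ^ 2 := by nlinarith [norm_nonneg z]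
    rw [h5] at h6
    have h7 : 0 < (1 - ρ ^ 2) / (1 + ρ ^ 2 * ξ.re ^ 2) := div_pos (by linarith) (by positivity)
    have h8 := (pos_iff_pos_of_mul_pos h6).1 h7
    exact abs_lt.1 ((sq_lt_one_iff_abs_lt_one _).1 (by linarith))
  exact ⟨ω, ρ, hω, hρ2, main z₁ h₁ rfl, main z₂ h₂ him.symm⟩

end Geodesics

/-! ### Restriction to geodesics and injectivity in the disk -/

section CurveOnGeodesic

variable {E : Type*} [NormedAddCommGroup E] [InnerProductSpace ℂ E] [CompleteSpace E]
  {φ : ℂ → E} {p : ℝ → ℝ}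

/-- The Schwarzian bound passes from the disk to the restriction of `φ` to a hyperbolic geodesic. -/
theorem IsNehariFunction.exists_derivs_hypGeodesic (hp : IsNehariFunction p)
    (hφ : DifferentiableOn ℂ φ (ball 0 1)) (h0 : ∀ z ∈ ball (0 : ℂ) 1, deriv φ z ≠ 0)
    (hS : ∀ z ∈ ball (0 : ℂ) 1,
      ‖schwarzianForm (deriv φ z) (deriv (deriv φ) z) (deriv (deriv (deriv φ)) z)‖
        + 3 / 2 * curvatureForm (deriv φ z) (deriv (deriv φ) z) ≤ 2 * p ‖z‖)
    {ω : ℂ} {ρ : ℝ} (hω : ‖ω‖ = 1) (hρ : ρ ^ 2 < 1) :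
    ∃ A B D : ℝ → E, ∀ x ∈ Ioo (-1 : ℝ) 1,
      HasDerivAt (fun x => φ (hypGeodesic ω ρ x)) (A x) x ∧
      HasDerivAt A (B x) x ∧ HasDerivAt B (D x) x ∧ A x ≠ 0 ∧
      ‖schwarzianForm (A x) (B x) (D x)‖ + 3 / 2 * curvatureForm (A x) (B x) ≤ 2 * p x ∧
      A x = (ω * (1 - ρ ^ 2) / (1 - Complex.I * ρ * x) ^ 2) • deriv φ (hypGeodesic ω ρ x) := by
  have hO : IsOpen (ball (0 : ℂ) 1) := isOpen_ball
  have e1 := hφ.deriv hO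
  have e2 := e1.deriv hO
  set K : ℂ := ω * (1 - ρ ^ 2) with hK
  set T := hypGeodesic ω ρ with hT
  set T₁ : ℝ → ℂ := fun x => K / (1 - Complex.I * ρ * x) ^ 2 with hT₁
  set T₂ : ℝ → ℂ := fun x => (2 : ℕ) * Complex.I * ρ * K / (1 - Complex.I * ρ * x) ^ (2 + 1) with hT₂
  set T₃ : ℝ → ℂ := fun x => (2 + 1 : ℕ) * Complex.I * ρ * ((2 : ℕ) * Complex.I * ρ * K)
    / (1 - Complex.I * ρ * x) ^ (2 + 1 + 1) with hT₃
  have d0 : ∀ x, HasDerivAt T (T₁ x) x := fun x => hasDerivAt_hypGeodesic ω ρ x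
  have d1 : ∀ x, HasDerivAt T₁ (T₂ x) x := fun x => hasDerivAt_const_div_one_sub_pow K ρ x 2
  have d2 : ∀ x, HasDerivAt T₂ (T₃ x) x := fun x => hasDerivAt_const_div_one_sub_pow _ ρ x _
  have hK0 : K ≠ 0 := by
    refine mul_ne_zero (norm_ne_zero_iff.1 (by rw [hω]; exact one_ne_zero)) ?_
    exact_mod_cast (by linarith : 1 - ρ ^ 2 ≠ 0)
  have hT₁0 : ∀ x, T₁ x ≠ 0 := fun x =>
    div_ne_zero hK0 (pow_ne_zero 2 (one_sub_I_mul_ne_zero ρ x))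
  refine ⟨fun x => T₁ x • deriv φ (T x),
    fun x => T₁ x ^ 2 • deriv (deriv φ) (T x) + T₂ x • deriv φ (T x),
    fun x => T₁ x ^ 3 • deriv (deriv (deriv φ)) (T x) + (3 * T₁ x * T₂ x) • deriv (deriv φ) (T x)
      + T₃ x • deriv φ (T x), fun x hx => ?_⟩
  have hTx : T x ∈ ball (0 : ℂ) 1 := hypGeodesic_mem_ball hω hρ hx
  have hnh := hO.mem_nhds hTx
  have f0 : HasDerivAt (fun x => φ (T x)) (T₁ x • deriv φ (T x)) x :=
    (hφ.differentiableAt hnh).hasDerivAt.scomp x (d0 x)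
  have f1 : HasDerivAt (fun x => deriv φ (T x)) (T₁ x • deriv (deriv φ) (T x)) x :=
    (e1.differentiableAt hnh).hasDerivAt.scomp x (d0 x)
  have f2 : HasDerivAt (fun x => deriv (deriv φ) (T x)) (T₁ x • deriv (deriv (deriv φ)) (T x)) x :=
    (e2.differentiableAt hnh).hasDerivAt.scomp x (d0 x)
  refine ⟨f0, ((d1 x).smul f1).congr_deriv ?_,
    ((((d1 x).pow 2).smul f2).add ((d2 x).smul f1)).congr_deriv ?_,
    smul_ne_zero (hT₁0 x) (h0 _ hTx), ?_, rfl⟩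
  · simp only [smul_smul, sq]
  · simp only [Pi.pow_apply, Nat.cast_ofNat, Nat.add_one_sub_one, pow_one]
    module
  · have hODE : 2 * T₃ x * T₁ x = 3 * T₂ x ^ 2 := by
      have hne := one_sub_I_mul_ne_zero ρ x
      simp only [hT₁, hT₂, hT₃]
      push_cast
      field_simp
    rw [schwarzianForm_reparam (h0 _ hTx) (hT₁0 x) hODE,
      curvatureForm_reparam (h0 _ hTx) (hT₁0 x), norm_mul, norm_pow]
    have h1 := hS _ hTx
    have hn1 : ‖T₁ x‖ = (1 - ρ ^ 2) / (1 + ρ ^ 2 * x ^ 2) := by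
      simp only [hT₁, hK]
      rw [norm_div, norm_pow, normSq_one_sub_I_mul, norm_mul, hω, one_mul]
      congr 1
      have : ((1 : ℂ) - (ρ : ℂ) ^ 2) = ((1 - ρ ^ 2 : ℝ) : ℂ) := by push_cast; ring
      rw [this, Complex.norm_real, Real.norm_eq_abs, abs_of_pos (by linarith)]
    have h2 : 1 - ‖T x‖ ^ 2 = ‖T₁ x‖ * (1 - x ^ 2) := by
      rw [hn1]; exact one_sub_norm_sq_hypGeodesic hω x
    have hTx1 : ‖T x‖ < 1 := mem_ball_zero_iff.1 hTx
    have hxT := abs_le_norm_hypGeodesic (ρ := ρ) hω hx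
    -- Since |x| ≤ |T(x)| and 1 - |T|² = |T'|(1 - x²), the monotonicity of (1-x²)²p reads |T'|²
    -- p(|T|) ≤ p(x).
    have h3 := hp.anti (a := |x|) (b := ‖T x‖) ⟨abs_nonneg _, hxT.trans_lt hTx1⟩
      ⟨norm_nonneg _, hTx1⟩ hxT
    have h4 : p |x| = p x := by
      rcases abs_choice x with h | h <;> rw [h]
      exact hp.even x hx
    simp only [h2, h4, sq_abs, mul_pow] at h3
    have hx2 : 0 < (1 - x ^ 2) ^ 2 := by
      have : 0 < 1 - x ^ 2 := by nlinarith [hx.1, hx.2]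
      positivity
    have h5 : ‖T₁ x‖ ^ 2 * p ‖T x‖ ≤ p x := by
      have : (1 - x ^ 2) ^ 2 * (‖T₁ x‖ ^ 2 * p ‖T x‖) ≤ (1 - x ^ 2) ^ 2 * p x := by
        nlinarith [h3]
      exact le_of_mul_le_mul_left this hx2
    nlinarith [mul_le_mul_of_nonneg_left h1 (sq_nonneg ‖T₁ x‖)]

/-- A holomorphic curve satisfying the Schwarzian bound is injective. -/
theorem IsNehariFunction.injOn_ball (hp : IsNehariFunction p)
    (hφ : DifferentiableOn ℂ φ (ball 0 1)) (h0 : ∀ z ∈ ball (0 : ℂ) 1, deriv φ z ≠ 0)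
    (hS : ∀ z ∈ ball (0 : ℂ) 1,
      ‖schwarzianForm (deriv φ z) (deriv (deriv φ) z) (deriv (deriv (deriv φ)) z)‖
        + 3 / 2 * curvatureForm (deriv φ z) (deriv (deriv φ) z) ≤ 2 * p ‖z‖) :
    InjOn φ (ball 0 1) := by
  intro z₁ h₁ z₂ h₂ heq
  by_contra hne
  obtain ⟨ω, ρ, hω, hρ, ⟨x₁, hx₁, rfl⟩, ⟨x₂, hx₂, rfl⟩⟩ := exists_hypGeodesic h₁ h₂ hne
  obtain ⟨A, B, D, H⟩ := hp.exists_derivs_hypGeodesic hφ h0 hS hω hρ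
  let _ : InnerProductSpace ℝ E := InnerProductSpace.complexToReal
  have hre : ∀ x y : E, inner ℝ x y = (inner ℂ x y).re := fun _ _ => rfl
  refine hne (congrArg _ (hp.injOn_curve (c := fun x => φ (hypGeodesic ω ρ x)) (A := A) (B := B)
    (D := D) (fun x hx => (H x hx).1) (fun x hx => (H x hx).2.1) (fun x hx => (H x hx).2.2.1)
    (fun x hx => (H x hx).2.2.2.1) (fun x hx => ?_) hx₁ hx₂ heq))
  obtain ⟨-, -, -, hA0, hb, -⟩ := H x hx
  have hn := norm_ne_zero_iff.2 hA0
  -- Re S + (3/2)κ equals the real curve Schwarzian exactly; this is where the coefficient 3/2 is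
  -- needed.
  refine le_trans (le_of_eq ?_) ((add_le_add_left (Complex.re_le_norm _) _).trans hb)
  rw [hre, hre, schwarzianForm, curvatureForm, ← Complex.normSq_eq_norm_sq, Complex.normSq_apply,
    Complex.sub_re, Complex.div_ofReal_re]
  have : (3 / 2 * (inner ℂ (A x) (B x) / ((‖A x‖ ^ 2 : ℝ) : ℂ)) ^ 2).re
      = 3 / 2 * ((inner ℂ (A x) (B x)).re ^ 2 - (inner ℂ (A x) (B x)).im ^ 2) / ‖A x‖ ^ 4 := by
    have : (3 / 2 * (inner ℂ (A x) (B x) / ((‖A x‖ ^ 2 : ℝ) : ℂ)) ^ 2)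
        = ((3 / 2 / ‖A x‖ ^ 4 : ℝ) : ℂ) * (inner ℂ (A x) (B x)) ^ 2 := by
      push_cast
      field_simp
    rw [this, Complex.re_ofReal_mul, sq, Complex.mul_re]
    ring
  rw [this]
  field_simp
  ring

end CurveOnGeodesic

/-! ### Comparison with the solution U of U'' = pU -/

section Comparison

/-- Up to the first time at which ‖h‖ reaches V, one has ‖h''‖ ≤ qV = V''. Two integrations show
that the gap V - ‖h‖ never falls below its positive initial value, so that time never comes. -/
theorem norm_le_of_norm_deriv2_le {F : Type*} [NormedAddCommGroup F] [NormedSpace ℝ F]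
    {h h₁ h₂ : ℝ → F} {V V₁ q : ℝ → ℝ} {x : ℝ} (hx : 0 ≤ x)
    (hh : ∀ t ∈ Icc 0 x, HasDerivAt h (h₁ t) t) (hh₁ : ∀ t ∈ Icc 0 x, HasDerivAt h₁ (h₂ t) t)
    (hV : ∀ t ∈ Icc 0 x, HasDerivAt V (V₁ t) t)
    (hV₁ : ∀ t ∈ Icc 0 x, HasDerivAt V₁ (q t * V t) t) (hq : ∀ t ∈ Icc 0 x, 0 ≤ q t)
    (hle : ∀ t ∈ Icc 0 x, ‖h₂ t‖ ≤ q t * ‖h t‖) (h0 : ‖h 0‖ < V 0) (h1 : ‖h₁ 0‖ ≤ V₁ 0) :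
    ‖h x‖ ≤ V x := by
  by_contra hcon
  rw [not_le] at hcon
  have hhc : ContinuousOn h (Icc 0 x) := fun t ht => (hh t ht).continuousAt.continuousWithinAt
  have hVc : ContinuousOn V (Icc 0 x) := fun t ht => (hV t ht).continuousAt.continuousWithinAt
  set Z : Set ℝ := {t ∈ Icc 0 x | V t ≤ ‖h t‖} with hZ
  have hZc : IsClosed Z := isClosed_Icc.isClosed_le hVc hhc.norm
  have hZb : BddBelow Z := ⟨0, fun t ht => ht.1.1⟩
  have hm : sInf Z ∈ Z := hZc.csInf_mem ⟨x, ⟨hx, le_rfl⟩, hcon.le⟩ hZb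
  set m := sInf Z
  have hsub : Icc 0 m ⊆ Icc 0 x := Icc_subset_Icc_right hm.1.2
  have hlt : ∀ t ∈ Ico 0 m, ‖h t‖ ≤ V t := fun t ht => by
    by_contra hc
    exact absurd (csInf_le hZb ⟨hsub (Ico_subset_Icc_self ht), (not_le.1 hc).le⟩) (not_le.2 ht.2)
  have b1 : ∀ t ∈ Icc 0 m, ‖h₁ t‖ ≤ V₁ t := by
    intro t ht
    refine image_norm_le_of_norm_deriv_right_le_deriv_boundary' (f := h₁) (f' := h₂)
      (fun s hs => (hh₁ s (hsub hs)).continuousAt.continuousWithinAt)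
      (fun s hs => (hh₁ s (hsub (Ico_subset_Icc_self hs))).hasDerivWithinAt) h1
      (fun s hs => (hV₁ s (hsub hs)).continuousAt.continuousWithinAt)
      (fun s hs => (hV₁ s (hsub (Ico_subset_Icc_self hs))).hasDerivWithinAt)
      (fun s hs => ?_) ht
    have hs' := hsub (Ico_subset_Icc_self hs)
    exact (hle s hs').trans (mul_le_mul_of_nonneg_left (hlt s hs) (hq s hs'))
  have b2 := image_norm_le_of_norm_deriv_right_le_deriv_boundary' (f := h) (f' := h₁)
    (B := fun t => V t - (V 0 - ‖h 0‖)) (B' := V₁) (hhc.mono hsub)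
    (fun s hs => (hh s (hsub (Ico_subset_Icc_self hs))).hasDerivWithinAt) (by simp)
    ((hVc.mono hsub).sub continuousOn_const)
    (fun s hs => ((hV s (hsub (Ico_subset_Icc_self hs))).sub_const _).hasDerivWithinAt)
    (fun s hs => b1 s (Ico_subset_Icc_self hs)) ⟨hm.1.1, le_rfl⟩
  have := hm.2
  linarith

variable {p U : ℝ → ℝ}

/-- (UU')' = U'² + pU² ≥ 0 and UU' vanishes at 0, so U² is nondecreasing on [0,1). -/
theorem SolvesLinearODE.one_le_sq_of_nonneg (hU : SolvesLinearODE p U) (hU0 : U 0 = 1)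
    (hU0' : deriv U 0 = 0) (hp : ∀ x ∈ Ioo (-1 : ℝ) 1, 0 ≤ p x) {x : ℝ} (hx : x ∈ Ico (0 : ℝ) 1) :
    1 ≤ U x ^ 2 := by
  have hsub : Ico (0 : ℝ) 1 ⊆ Ioo (-1) 1 := fun t ht => ⟨by linarith [ht.1], ht.2⟩
  have hz : (0 : ℝ) ∈ Ico (0 : ℝ) 1 := ⟨le_rfl, one_pos⟩
  have d1 : ∀ t ∈ Ico (0 : ℝ) 1, HasDerivAt (fun t => U t * deriv U t)
      (deriv U t * deriv U t + U t * (p t * U t)) t := fun t ht =>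
    (hU t (hsub ht)).1.mul (hU t (hsub ht)).2
  have d2 : ∀ t ∈ Ico (0 : ℝ) 1, HasDerivAt (fun t => U t ^ 2) (2 * (U t * deriv U t)) t :=
    fun t ht => ((hU t (hsub ht)).1.pow 2).congr_deriv (by simp; ring)
  have m1 : MonotoneOn (fun t => U t * deriv U t) (Ico 0 1) := by
    refine monotoneOn_of_deriv_nonneg (convex_Ico _ _)
      (fun t ht => (d1 t ht).continuousAt.continuousWithinAt)
      (fun t ht => (d1 t (interior_subset ht)).differentiableAt.differentiableWithinAt)
      (fun t ht => ?_)
    have ht := interior_subset ht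
    rw [(d1 t ht).deriv]
    nlinarith [mul_nonneg (hp t (hsub ht)) (sq_nonneg (U t)), sq_nonneg (deriv U t)]
  have m2 : MonotoneOn (fun t => U t ^ 2) (Ico 0 1) := by
    refine monotoneOn_of_deriv_nonneg (convex_Ico _ _)
      (fun t ht => (d2 t ht).continuousAt.continuousWithinAt)
      (fun t ht => (d2 t (interior_subset ht)).differentiableAt.differentiableWithinAt)
      (fun t ht => ?_)
    have ht := interior_subset ht
    rw [(d2 t ht).deriv]
    have h3 := m1 hz ht ht.1
    simp only [hU0', mul_zero] at h3
    linarith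
  simpa [hU0] using m2 hz hx hx.1

theorem SolvesLinearODE.comp_neg (hU : SolvesLinearODE p U) :
    SolvesLinearODE (fun x => p (-x)) (fun x => U (-x)) := by
  intro x hx
  have hx' : -x ∈ Ioo (-1 : ℝ) 1 := ⟨by linarith [hx.2], by linarith [hx.1]⟩
  have hd : deriv (fun x => U (-x)) = fun x => -deriv U (-x) := by
    funext t; exact deriv_comp_neg U t
  rw [hd]
  refine ⟨((hU _ hx').1.comp x (hasDerivAt_neg x)).congr_deriv (by ring),
    (((hU _ hx').2.comp x (hasDerivAt_neg x)).neg).congr_deriv (by ring)⟩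

/-- The even solution of `U'' = pU` with `p ≥ 0` and `U(0) = 1` is positive with `U² ≥ 1`. -/
theorem SolvesLinearODE.pos_and_one_le_sq (hU : SolvesLinearODE p U) (hU0 : U 0 = 1)
    (hU0' : deriv U 0 = 0) (hp : ∀ x ∈ Ioo (-1 : ℝ) 1, 0 ≤ p x) {x : ℝ} (hx : x ∈ Ioo (-1 : ℝ) 1) :
    0 < U x ∧ 1 ≤ U x ^ 2 := by
  have hsq : ∀ t ∈ Ioo (-1 : ℝ) 1, 1 ≤ U t ^ 2 := by
    intro t ht
    rcases le_total 0 t with h | h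
    · exact hU.one_le_sq_of_nonneg hU0 hU0' hp ⟨h, ht.2⟩
    · have := hU.comp_neg.one_le_sq_of_nonneg (x := -t) (by simpa using hU0)
        (by rw [deriv_comp_neg]; simpa using hU0')
        (fun s hs => hp _ ⟨by linarith [hs.2], by linarith [hs.1]⟩)
        ⟨by linarith, by linarith [ht.1]⟩
      simpa using this
  refine ⟨?_, hsq x hx⟩
  by_contra hneg
  have hc : ContinuousOn U (Ioo (-1) 1) := fun t ht => (hU t ht).1.continuousAt.continuousWithinAt
  obtain ⟨t, ht, ht0⟩ := isPreconnected_Ioo.intermediate_value hx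
    (show (0 : ℝ) ∈ Ioo (-1 : ℝ) 1 by norm_num) hc
    (show (0 : ℝ) ∈ Icc (U x) (U 0) from ⟨not_lt.1 hneg, by rw [hU0]; exact zero_le_one⟩)
  have := hsq t ht
  rw [ht0] at this
  norm_num at this

theorem hasStrictDerivAt_extremalPsi (hUc : ContinuousOn U (Ioo (-1) 1))
    (hU : ∀ x ∈ Ioo (-1 : ℝ) 1, U x ≠ 0) {x : ℝ} (hx : x ∈ Ioo (-1 : ℝ) 1) :
    HasStrictDerivAt (extremalPsi U) (U x ^ 2)⁻¹ x := by
  have hc : ContinuousOn (fun t => (U t ^ 2)⁻¹) (Ioo (-1) 1) :=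
    (hUc.pow 2).inv₀ fun t ht => pow_ne_zero 2 (hU t ht)
  have hsub : uIcc 0 x ⊆ Ioo (-1 : ℝ) 1 :=
    (ordConnected_Ioo).uIcc_subset (by norm_num) hx
  exact intervalIntegral.integral_hasStrictDerivAt_right (hc.mono hsub).intervalIntegrable
    (hc.stronglyMeasurableAtFilter isOpen_Ioo x hx) (hc.continuousAt (isOpen_Ioo.mem_nhds hx))

theorem extremalPsi_nonneg {x : ℝ} (hx : 0 ≤ x) : 0 ≤ extremalPsi U x :=
  intervalIntegral.integral_nonneg hx fun t _ => by positivity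

/-- Solutions of `|h''| ≤ p|h|` with `|h(0)| = 1` are dominated by the extremal solution. -/
theorem SolvesLinearODE.norm_le_mul_extremalPsi {F : Type*} [NormedAddCommGroup F]
    [NormedSpace ℝ F] (hU : SolvesLinearODE p U) (hU0 : U 0 = 1)
    (hU0' : deriv U 0 = 0) (hp : ∀ x ∈ Ioo (-1 : ℝ) 1, 0 ≤ p x) {h h₁ h₂ : ℝ → F}
    (hh : ∀ t ∈ Ioo (-1 : ℝ) 1, HasDerivAt h (h₁ t) t)
    (hh₁ : ∀ t ∈ Ioo (-1 : ℝ) 1, HasDerivAt h₁ (h₂ t) t)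
    (hle : ∀ t ∈ Ioo (-1 : ℝ) 1, ‖h₂ t‖ ≤ p t * ‖h t‖) (h0 : ‖h 0‖ = 1)
    {x : ℝ} (hx : x ∈ Ico (0 : ℝ) 1) :
    ‖h x‖ ≤ U x * (1 + ‖h₁ 0‖ * extremalPsi U x) := by
  have hsub : Icc (0 : ℝ) x ⊆ Ioo (-1) 1 := fun t ht => ⟨by linarith [ht.1], ht.2.trans_lt hx.2⟩
  have hpos : ∀ t ∈ Ioo (-1 : ℝ) 1, 0 < U t := fun t ht =>
    (hU.pos_and_one_le_sq hU0 hU0' hp ht).1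
  have hUc : ContinuousOn U (Ioo (-1) 1) := fun t ht => (hU t ht).1.continuousAt.continuousWithinAt
  have hΨ : ∀ t ∈ Ioo (-1 : ℝ) 1, HasDerivAt (extremalPsi U) (U t ^ 2)⁻¹ t := fun t ht =>
    (hasStrictDerivAt_extremalPsi hUc (fun s hs => (hpos s hs).ne') ht).hasDerivAt
  have hΨ0 : extremalPsi U 0 = 0 := by simp [extremalPsi]
  set c := ‖h₁ 0‖
  refine le_of_forall_pos_le_add fun e he => ?_
  have hUx := hpos x (hsub ⟨hx.1, le_rfl⟩)
  -- The comparison function is (1+ε)U + cUΨ, where UΨ is the second solution, with value 0 and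
  -- slope 1 at 0. The ε makes the initial inequality strict and costs exactly e at x.
  set ε := e / U x with hε
  have hεpos : 0 < ε := by positivity
  have key := norm_le_of_norm_deriv2_le (h := h) (h₁ := h₁) (h₂ := h₂) (q := p)
    (V := fun t => (1 + ε) * U t + c * (U t * extremalPsi U t))
    (V₁ := fun t => (1 + ε) * deriv U t + c * (deriv U t * extremalPsi U t + (U t)⁻¹))
    hx.1 (fun t ht => hh t (hsub ht)) (fun t ht => hh₁ t (hsub ht))
    (fun t ht => ?_) (fun t ht => ?_) (fun t ht => hp t (hsub ht)) (fun t ht => hle t (hsub ht))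
    ?_ ?_
  · refine key.trans (le_of_eq ?_)
    have : ε * U x = e := div_mul_cancel₀ _ hUx.ne'
    linear_combination this
  · have ht := hsub ht
    have := (hpos t ht).ne'
    refine (((hU t ht).1.const_mul (1 + ε)).add
      (((hU t ht).1.mul (hΨ t ht)).const_mul c)).congr_deriv ?_
    field_simp
  · have ht := hsub ht
    have := (hpos t ht).ne'
    refine (((hU t ht).2.const_mul (1 + ε)).add
      ((((hU t ht).2.mul (hΨ t ht)).add ((hU t ht).1.inv this)).const_mul c)).congr_deriv ?_
    field_simp
    ring
  · simp only [hU0, hΨ0, h0]; linarith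
  · simp [hU0, hU0', hΨ0, c]

end Comparison

/-! ### Lower bound for |φ'| -/

section Distortion

variable {E : Type*} [NormedAddCommGroup E] [InnerProductSpace ℂ E] {p U : ℝ → ℝ}

/-- A complex function h with |h|² = 1/|A| solves a linear equation with complex coefficient -(S +
κ)/2, of modulus at most p. The upper bound for |h| in terms of U and Ψ is then a lower bound for
|A|. -/
theorem SolvesLinearODE.curve_distortion (hU : SolvesLinearODE p U) (hU0 : U 0 = 1)
    (hU0' : deriv U 0 = 0) (hp : ∀ x ∈ Ioo (-1 : ℝ) 1, 0 ≤ p x) {A B D : ℝ → E}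
    (hA : ∀ x ∈ Ioo (-1 : ℝ) 1, HasDerivAt A (B x) x)
    (hB : ∀ x ∈ Ioo (-1 : ℝ) 1, HasDerivAt B (D x) x)
    (hne : ∀ x ∈ Ioo (-1 : ℝ) 1, A x ≠ 0)
    (hS : ∀ x ∈ Ioo (-1 : ℝ) 1,
      ‖schwarzianForm (A x) (B x) (D x)‖ + curvatureForm (A x) (B x) ≤ 2 * p x)
    (hA0 : ‖A 0‖ = 1) {x : ℝ} (hx : x ∈ Ico (0 : ℝ) 1) :
    ((U x * (1 + ‖B 0‖ / 2 * extremalPsi U x)) ^ 2)⁻¹ ≤ ‖A x‖ := by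
  let _ : InnerProductSpace ℝ E := InnerProductSpace.complexToReal
  have hre : ∀ x y : E, inner ℝ x y = (inner ℂ x y).re := fun _ _ => rfl
  have hsub : Icc (0 : ℝ) x ⊆ Ioo (-1) 1 := fun t ht => ⟨by linarith [ht.1], ht.2.trans_lt hx.2⟩
  have h0I : (0 : ℝ) ∈ Ioo (-1 : ℝ) 1 := by norm_num
  set γ : ℝ → ℂ := fun t => 1 / 2 * (inner ℂ (A t) (B t) / (‖A t‖ ^ 2 : ℝ)) with hγ
  set γ' : ℝ → ℂ := fun t => 1 / 2 * ((inner ℂ (A t) (D t) + (‖B t‖ ^ 2 : ℝ)) / (‖A t‖ ^ 2 : ℝ)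
    - inner ℂ (A t) (B t) * (inner ℂ (A t) (B t) + starRingEnd ℂ (inner ℂ (A t) (B t)))
      / (‖A t‖ ^ 2 : ℝ) ^ 2) with hγ'
  have hγd : ∀ t ∈ Ioo (-1 : ℝ) 1, HasDerivAt γ (γ' t) t := by
    intro t ht
    have hn : ((‖A t‖ ^ 2 : ℝ) : ℂ) ≠ 0 := by simpa using hne t ht
    have h1 := (hA t ht).inner ℂ (hB t ht)
    have h2 := (hA t ht).inner ℂ (hA t ht)
    simp only [inner_self_ofReal] at h1 h2
    refine ((h1.div h2 hn).const_mul (1 / 2)).congr_deriv ?_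
    simp only [hγ']
    rw [inner_conj_symm]
    field_simp
  have hγc : ContinuousOn γ (Ioo (-1) 1) := fun t ht =>
    (hγd t ht).continuousAt.continuousWithinAt
  set h : ℝ → ℂ := fun t => Complex.exp (-∫ s in (0 : ℝ)..t, γ s) with hh
  have hhd : ∀ t ∈ Ioo (-1 : ℝ) 1, HasDerivAt h (-γ t * h t) t := by
    intro t ht
    have hs : uIcc 0 t ⊆ Ioo (-1 : ℝ) 1 := ordConnected_Ioo.uIcc_subset h0I ht
    have h1 := intervalIntegral.integral_hasDerivAt_right (hγc.mono hs).intervalIntegrable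
      (hγc.stronglyMeasurableAtFilter isOpen_Ioo t ht) (hγc.continuousAt (isOpen_Ioo.mem_nhds ht))
    exact h1.neg.cexp.congr_deriv (by simp only [hh, Pi.neg_apply]; ring)
  have hhd2 : ∀ t ∈ Ioo (-1 : ℝ) 1,
      HasDerivAt (fun t => -γ t * h t) ((γ t ^ 2 - γ' t) * h t) t := fun t ht =>
    ((hγd t ht).neg.mul (hhd t ht)).congr_deriv (by simp only [Pi.neg_apply]; ring)
  have hle : ∀ t ∈ Ioo (-1 : ℝ) 1, ‖(γ t ^ 2 - γ' t) * h t‖ ≤ p t * ‖h t‖ := by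
    intro t ht
    rw [norm_mul]
    refine mul_le_mul_of_nonneg_right ?_ (norm_nonneg _)
    have hn : (‖A t‖ : ℂ) ≠ 0 := by exact_mod_cast norm_ne_zero_iff.2 (hne t ht)
    -- Differentiating along a real direction brings in the antilinear part of the differential,
    -- which is the source of κ beside S.
    have e1 : γ t ^ 2 - γ' t = -(1 / 2 * schwarzianForm (A t) (B t) (D t))
        - ((1 / 2 * curvatureForm (A t) (B t) : ℝ) : ℂ) := by
      have hq : ((‖inner ℂ (A t) (B t)‖ ^ 2 : ℝ) : ℂ)
          = inner ℂ (A t) (B t) * starRingEnd ℂ (inner ℂ (A t) (B t)) := by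
        rw [Complex.mul_conj, Complex.normSq_eq_norm_sq]
      simp only [hγ, hγ', schwarzianForm, curvatureForm]
      push_cast at hq ⊢
      rw [hq]
      field_simp
      ring
    rw [e1]
    refine (norm_sub_le _ _).trans ?_
    rw [norm_neg, norm_mul, Complex.norm_real, Real.norm_eq_abs,
      abs_of_nonneg (mul_nonneg (by norm_num) (curvatureForm_nonneg _ _))]
    have := hS t ht
    norm_num
    linarith
  have hh0 : h 0 = 1 := by simp [hh]
  have hmain := hU.norm_le_mul_extremalPsi hU0 hU0' hp hhd hhd2 hle (by simp [hh0]) hx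
  -- (log|h|)' = -Re γ and (log|A|)' = 2 Re γ, so the product is constant.
  have hconst : (‖h x‖ ^ 2) ^ 2 * ‖A x‖ ^ 2 = 1 := by
    have hd : ∀ t ∈ Ioo (-1 : ℝ) 1, HasDerivAt (fun t => (‖h t‖ ^ 2) ^ 2 * ‖A t‖ ^ 2) 0 t := by
      intro t ht
      have hn : ‖A t‖ ≠ 0 := norm_ne_zero_iff.2 (hne t ht)
      refine (((hhd t ht).norm_sq.pow 2).mul (hA t ht).norm_sq).congr_deriv ?_
      have e1 : inner ℝ (h t) (-γ t * h t) = -(γ t).re * ‖h t‖ ^ 2 := by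
        rw [Complex.inner, ← Complex.normSq_eq_norm_sq, mul_assoc, Complex.mul_conj,
          Complex.re_mul_ofReal, Complex.neg_re]
      have e2 : inner ℝ (A t) (B t) = 2 * (γ t).re * ‖A t‖ ^ 2 := by
        have : γ t = ((1 / 2 / ‖A t‖ ^ 2 : ℝ) : ℂ) * inner ℂ (A t) (B t) := by
          simp only [hγ]; push_cast; ring
        rw [hre, this, Complex.re_ofReal_mul]
        field_simp
      rw [e1, e2]
      simp
      ring
    have := constant_of_has_deriv_right_zero (a := 0) (b := x)
      (fun t ht => (hd t (hsub ht)).continuousAt.continuousWithinAt)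
      (fun t ht => (hd t (hsub (Ico_subset_Icc_self ht))).hasDerivWithinAt) x ⟨hx.1, le_rfl⟩
    rw [this, hh0, hA0]
    norm_num
  have hAx : 0 < ‖A x‖ := norm_pos_iff.2 (hne x (hsub ⟨hx.1, le_rfl⟩))
  have h2 : ‖h x‖ ^ 2 * ‖A x‖ = 1 := by
    have h3 : (‖h x‖ ^ 2 * ‖A x‖) ^ 2 = 1 := by rw [mul_pow, hconst]
    exact (pow_eq_one_iff_of_nonneg (by positivity) two_ne_zero).1 h3
  have hhx : 0 < ‖h x‖ := norm_pos_iff.2 (Complex.exp_ne_zero _)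
  have hUx := (hU.pos_and_one_le_sq hU0 hU0' hp (hsub ⟨hx.1, le_rfl⟩)).1
  have hΨ := extremalPsi_nonneg (U := U) hx.1
  have hc : ‖-γ 0 * h 0‖ ≤ ‖B 0‖ / 2 := by
    simp only [hγ]
    rw [hh0, hA0, mul_one, norm_neg]
    have h4 := norm_inner_le_norm (𝕜 := ℂ) (A 0) (B 0)
    rw [hA0] at h4
    simp
    linarith
  have h5 : ‖h x‖ ≤ U x * (1 + ‖B 0‖ / 2 * extremalPsi U x) := hmain.trans (by gcongr)
  have h6 : ‖A x‖ = (‖h x‖ ^ 2)⁻¹ := by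
    exact eq_inv_of_mul_eq_one_left (by rw [mul_comm]; exact h2)
  rw [h6]
  gcongr

/-- Lower bound for `|φ'|` under the Schwarzian bound. -/
theorem IsNehariFunction.norm_deriv_ge [CompleteSpace E] {φ : ℂ → E} (hp : IsNehariFunction p)
    (hU : SolvesLinearODE p U) (hU0 : U 0 = 1) (hU0' : deriv U 0 = 0)
    (hφ : DifferentiableOn ℂ φ (ball 0 1)) (h0 : ∀ z ∈ ball (0 : ℂ) 1, deriv φ z ≠ 0)
    (hS : ∀ z ∈ ball (0 : ℂ) 1,
      ‖schwarzianForm (deriv φ z) (deriv (deriv φ) z) (deriv (deriv (deriv φ)) z)‖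
        + 3 / 2 * curvatureForm (deriv φ z) (deriv (deriv φ) z) ≤ 2 * p ‖z‖)
    (hnorm : ‖deriv φ 0‖ = 1) {z : ℂ} (hz : z ∈ ball (0 : ℂ) 1) :
    ((U ‖z‖ * (1 + ‖deriv (deriv φ) 0‖ / 2 * extremalPsi U ‖z‖)) ^ 2)⁻¹ ≤ ‖deriv φ z‖ := by
  rw [mem_ball_zero_iff] at hz
  have hzI : ‖z‖ ∈ Ico (0 : ℝ) 1 := ⟨norm_nonneg _, hz⟩
  obtain ⟨ω, hω, hzω⟩ : ∃ ω : ℂ, ‖ω‖ = 1 ∧ z = ω * ‖z‖ := by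
    rcases eq_or_ne z 0 with rfl | hz0
    · exact ⟨1, by simp, by simp⟩
    · have : (‖z‖ : ℂ) ≠ 0 := by exact_mod_cast norm_ne_zero_iff.2 hz0
      exact ⟨z / ‖z‖, by simp [hz0], by field_simp⟩
  -- With ρ = 0 the geodesic is the diameter through z.
  obtain ⟨A, B, D, H⟩ := hp.exists_derivs_hypGeodesic hφ h0 hS hω (ρ := 0) (by norm_num)
  have hAx : ∀ x ∈ Ioo (-1 : ℝ) 1, A x = ω • deriv φ (ω * x) := fun x hx => by
    rw [(H x hx).2.2.2.2.2]; simp [hypGeodesic]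
  have hI : (0 : ℝ) ∈ Ioo (-1 : ℝ) 1 := by norm_num
  have hA0 : A 0 = ω • deriv φ 0 := by simpa using hAx 0 hI
  have hB0 : B 0 = ω • ω • deriv (deriv φ) 0 := by
    have hd : DifferentiableAt ℂ (deriv φ) (ω * (0 : ℝ)) := by
      simpa using (hφ.deriv isOpen_ball).differentiableAt (ball_mem_nhds (0 : ℂ) one_pos)
    have h1 : HasDerivAt (fun x : ℝ => ω * (x : ℂ)) ω 0 := by
      simpa using (Complex.ofRealCLM.hasDerivAt (x := 0)).const_mul ω
    have h2 : HasDerivAt (fun x : ℝ => ω • deriv φ (ω * x)) (ω • ω • deriv (deriv φ) 0) 0 := by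
      simpa using! ((hd.hasDerivAt.scomp (0 : ℝ) h1).const_smul ω)
    refine (H 0 hI).2.1.unique (h2.congr_of_eventuallyEq ?_)
    filter_upwards [Ioo_mem_nhds hI.1 hI.2] with x hx using hAx x hx
  have key := hU.curve_distortion hU0 hU0' (fun x hx => (hp.pos x hx).le) (A := A) (B := B) (D := D)
    (fun x hx => (H x hx).2.1) (fun x hx => (H x hx).2.2.1) (fun x hx => (H x hx).2.2.2.1)
    (fun x hx => by
      have := (H x hx).2.2.2.2.1
      have := curvatureForm_nonneg (A x) (B x)
      linarith)
    (by rw [hA0, norm_smul, hω, hnorm, one_mul]) hzI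
  rw [hB0, hAx ‖z‖ ⟨by linarith [hzI.1], hz⟩, ← hzω, norm_smul, norm_smul, norm_smul, hω] at key
  simpa using key

end Distortion

/-! ### Lengths of image curves -/

section Length

variable {E : Type*} [NormedAddCommGroup E] [NormedSpace ℂ E]

/-- If `|φ'(z)|` dominates the derivative of `Λ` at `|z|`, then `φ` almost expands the increments
of `Λ ∘ |·|` near `z`. -/
theorem eventually_abs_sub_le_mul_norm_sub {φ : ℂ → E} {Λ : ℝ → ℝ} {z : ℂ} {φ' : E} {l : ℝ}
    (hφ : HasStrictDerivAt φ φ' z) (hΛ : HasStrictDerivAt Λ l ‖z‖) (hl : 0 ≤ l) (hle : l ≤ ‖φ'‖)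
    (hφ' : φ' ≠ 0) {ε : ℝ} (hε : 0 < ε) :
    ∀ᶠ q : ℂ × ℂ in nhds (z, z),
      |Λ ‖q.1‖ - Λ ‖q.2‖| ≤ (1 + ε) * ‖φ q.1 - φ q.2‖ := by
  have hm : 0 < ‖φ'‖ := norm_pos_iff.2 hφ'
  -- Solves ‖φ'‖ + η = (1 + ε)(‖φ'‖ - η), so the two linearization errors are absorbed in the factor
  -- 1 + ε.
  set η := ε * ‖φ'‖ / (2 + ε) with hη
  have hη0 : 0 < η := by positivity
  have hη2 : ‖φ'‖ + η = (1 + ε) * (‖φ'‖ - η) := by rw [hη]; field_simp; ring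
  have h1 := hφ.isLittleO.def hη0
  have h2 := hΛ.isLittleO.def hη0
  have hcont : Filter.Tendsto (fun q : ℂ × ℂ => (‖q.1‖, ‖q.2‖)) (nhds (z, z))
      (nhds (‖z‖, ‖z‖)) :=
    (continuous_fst.norm.prodMk continuous_snd.norm).tendsto (z, z)
  filter_upwards [h1, hcont.eventually h2] with q hq1 hq2
  simp only [ContinuousLinearMap.toSpanSingleton_apply] at hq1 hq2
  have a1 : ‖q.1 - q.2‖ * (‖φ'‖ - η) ≤ ‖φ q.1 - φ q.2‖ := by
    have := norm_sub_norm_le ((q.1 - q.2) • φ') (φ q.1 - φ q.2)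
    rw [norm_sub_rev ((q.1 - q.2) • φ'), norm_smul] at this
    linarith
  have a2 : |Λ ‖q.1‖ - Λ ‖q.2‖| ≤ (l + η) * |‖q.1‖ - ‖q.2‖| := by
    have := norm_sub_norm_le (Λ ‖q.1‖ - Λ ‖q.2‖) ((‖q.1‖ - ‖q.2‖) • l)
    rw [norm_smul] at this
    simp only [Real.norm_eq_abs, abs_of_nonneg hl] at this hq2
    linarith
  calc |Λ ‖q.1‖ - Λ ‖q.2‖| ≤ (l + η) * |‖q.1‖ - ‖q.2‖| := a2
    _ ≤ (‖φ'‖ + η) * ‖q.1 - q.2‖ := by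
      gcongr
      exact abs_norm_sub_norm_le _ _
    _ = (1 + ε) * (‖q.1 - q.2‖ * (‖φ'‖ - η)) := by rw [hη2]; ring
    _ ≤ _ := by gcongr

/-- The curve γ is merely continuous, so nothing can be integrated along it. Instead the local
increment inequality, with factor 1 + ε, is summed over a partition subordinate to a cover by good
neighbourhoods, and then ε tends to 0. -/
theorem edist_le_eVariationOn_of_norm_deriv_ge {φ φ' : ℂ → E} {Λ l : ℝ → ℝ}
    (hφ : ∀ z ∈ ball (0 : ℂ) 1, HasStrictDerivAt φ (φ' z) z)
    (hφ' : ∀ z ∈ ball (0 : ℂ) 1, φ' z ≠ 0)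
    (hΛ : ∀ x ∈ Ico (0 : ℝ) 1, HasStrictDerivAt Λ (l x) x) (hl : ∀ x ∈ Ico (0 : ℝ) 1, 0 ≤ l x)
    (hle : ∀ z ∈ ball (0 : ℂ) 1, l ‖z‖ ≤ ‖φ' z‖) {γ : ℝ → ℂ}
    (hγ : ContinuousOn γ (Icc 0 1)) (hγb : MapsTo γ (Icc 0 1) (ball 0 1)) :
    edist (Λ ‖γ 0‖) (Λ ‖γ 1‖) ≤ eVariationOn (φ ∘ γ) (Icc 0 1) := by
  have almost : ∀ ε : ℝ, 0 < ε →
      edist (Λ ‖γ 0‖) (Λ ‖γ 1‖) ≤ ENNReal.ofReal (1 + ε) * eVariationOn (φ ∘ γ) (Icc 0 1) := by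
    intro ε hε
    have hloc : ∀ z : ball (0 : ℂ) 1, ∃ N : Set ℂ, IsOpen N ∧ (z : ℂ) ∈ N ∧
        ∀ a ∈ N, ∀ b ∈ N, |Λ ‖a‖ - Λ ‖b‖| ≤ (1 + ε) * ‖φ a - φ b‖ := by
      intro z
      have hz1 : ‖(z : ℂ)‖ ∈ Ico (0 : ℝ) 1 := ⟨norm_nonneg _, mem_ball_zero_iff.1 z.2⟩
      have h := eventually_abs_sub_le_mul_norm_sub (hφ z z.2) (hΛ _ hz1) (hl _ hz1)
        (hle z z.2) (hφ' z z.2) hε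
      obtain ⟨N, hNo, hNz, h⟩ := exists_nhds_square h
      exact ⟨N, hNo, hNz, fun a ha b hb => h (mk_mem_prod ha hb)⟩
    choose N hNo hNz hN using hloc
    have hγr : Continuous (fun t : Icc (0 : ℝ) 1 => γ t) := continuousOn_iff_continuous_domRestrict.1 hγ
    obtain ⟨t, ht0, htm, ⟨m, htm1⟩, htc⟩ := exists_monotone_Icc_subset_open_cover_Icc
      (zero_le_one' ℝ) (c := fun z => (fun t : Icc (0 : ℝ) 1 => γ t) ⁻¹' N z)
      (fun z => (hNo z).preimage hγr)
      (fun t _ => mem_iUnion.2 ⟨⟨γ t, hγb t.2⟩, hNz ⟨γ t, hγb t.2⟩⟩)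
    have hstep : ∀ i, edist (Λ ‖γ (t i)‖) (Λ ‖γ (t (i + 1))‖)
        ≤ ENNReal.ofReal (1 + ε) * edist ((φ ∘ γ) (t (i + 1))) ((φ ∘ γ) (t i)) := by
      intro i
      obtain ⟨z, hz⟩ := htc i
      have hmn := htm (Nat.le_succ i)
      have h1 := hN z _ (hz ⟨le_rfl, hmn⟩) _ (hz ⟨hmn, le_rfl⟩)
      rw [edist_dist, edist_dist, ← ENNReal.ofReal_mul (by positivity), Real.dist_eq,
        dist_comm, dist_eq_norm]
      exact ENNReal.ofReal_le_ofReal h1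
    calc edist (Λ ‖γ 0‖) (Λ ‖γ 1‖) = edist (Λ ‖γ (t 0)‖) (Λ ‖γ (t m)‖) := by
          rw [ht0, htm1 m le_rfl]
      _ ≤ ∑ i ∈ Finset.range m, edist (Λ ‖γ (t i)‖) (Λ ‖γ (t (i + 1))‖) :=
          edist_le_range_sum_edist (fun i => Λ ‖γ (t i)‖) m
      _ ≤ ∑ i ∈ Finset.range m,
            ENNReal.ofReal (1 + ε) * edist ((φ ∘ γ) (t (i + 1))) ((φ ∘ γ) (t i)) :=
          Finset.sum_le_sum fun i _ => hstep i
      _ = ENNReal.ofReal (1 + ε) *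
            ∑ i ∈ Finset.range m, edist ((φ ∘ γ) (t (i + 1))) ((φ ∘ γ) (t i)) := by
          rw [Finset.mul_sum]
      _ ≤ _ := by
          gcongr
          exact eVariationOn.sum_le (f := φ ∘ γ) (u := fun i => (t i : ℝ)) (fun i j h => htm h)
            (fun i => (t i).2)
  by_cases htop : eVariationOn (φ ∘ γ) (Icc 0 1) = ⊤
  · rw [htop]; exact le_top
  rw [← ENNReal.ofReal_toReal htop, edist_dist]
  set V := (eVariationOn (φ ∘ γ) (Icc 0 1)).toReal with hV
  have hV0 : 0 ≤ V := ENNReal.toReal_nonneg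
  refine ENNReal.ofReal_le_ofReal (le_of_forall_pos_le_add fun e he => ?_)
  -- The denominator V + 1 also covers V = 0.
  have h := almost (e / (V + 1)) (by positivity)
  rw [← ENNReal.ofReal_toReal htop, edist_dist, ← ENNReal.ofReal_mul (by positivity),
    ENNReal.ofReal_le_ofReal_iff (by positivity)] at h
  refine h.trans ?_
  have : e / (V + 1) * V ≤ e := by
    rw [div_mul_eq_mul_div, div_le_iff₀ (by positivity)]
    nlinarith
  change (1 + e / (V + 1)) * V ≤ V + e
  linarith

/-- Putting a segment in front of a curve lengthens its image by at most the Lipschitz constant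
times the length of the segment. -/
theorem exists_concat_segment {F : Type*} [PseudoEMetricSpace F] {φ : ℂ → F} {C : NNReal} {S : Set ℂ} (hS : Convex ℝ S)
    (hSb : S ⊆ ball 0 1) (hφ : LipschitzOnWith C φ S) {w z : ℂ} (hw : w ∈ S) (hz : z ∈ S)
    {γ : ℝ → ℂ} (hγ : ContinuousOn γ (Icc 0 1)) (hγb : MapsTo γ (Icc 0 1) (ball 0 1))
    (hγ0 : γ 0 = z) :
    ∃ g : ℝ → ℂ, ContinuousOn g (Icc 0 1) ∧ MapsTo g (Icc 0 1) (ball 0 1) ∧ g 0 = w ∧ g 1 = γ 1 ∧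
      eVariationOn (φ ∘ g) (Icc 0 1) ≤ C * edist w z + eVariationOn (φ ∘ γ) (Icc 0 1) := by
  set s : ℝ → ℂ := fun t => AffineMap.lineMap w z t with hs
  have hsS : MapsTo s (Icc 0 1) S := fun t ht => hS.lineMap_mem hw hz ht
  set g : ℝ → ℂ := fun t => if t ≤ 1 / 2 then s (2 * t) else γ (2 * t - 1) with hg
  have m1 : MapsTo (fun t : ℝ => 2 * t) (Icc 0 (1 / 2)) (Icc 0 1) := fun t ht =>
    ⟨by linarith [ht.1], by linarith [ht.2]⟩
  have m2 : MapsTo (fun t : ℝ => 2 * t - 1) (Icc (1 / 2) 1) (Icc 0 1) := fun t ht =>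
    ⟨by linarith [ht.1], by linarith [ht.2]⟩
  have e1 : EqOn g (s ∘ fun t => 2 * t) (Icc 0 (1 / 2)) := fun t ht => by
    simp only [hg, Function.comp]; rw [if_pos ht.2]
  have e2 : EqOn g (γ ∘ fun t => 2 * t - 1) (Icc (1 / 2) 1) := fun t ht => by
    rcases eq_or_lt_of_le ht.1 with h | h
    · subst h
      simp [hg, hs, hγ0]
    · simp only [hg, Function.comp]; rw [if_neg (not_le.2 h)]
  have hU : Icc (0 : ℝ) 1 = Icc 0 (1 / 2) ∪ Icc (1 / 2) 1 :=
    (Icc_union_Icc_eq_Icc (by norm_num) (by norm_num)).symm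
  have hsc : Continuous s := AffineMap.lineMap_continuous
  refine ⟨g, ?_, ?_, ?_, ?_, ?_⟩
  · rw [hU]
    refine ContinuousOn.union_of_isClosed ?_ ?_ isClosed_Icc isClosed_Icc
    · exact (hsc.comp (continuous_const.mul continuous_id)).continuousOn.congr e1
    · exact (hγ.comp (by fun_prop) m2).congr e2
  · rw [hU]
    rintro t (ht | ht)
    · rw [e1 ht]; exact hSb (hsS (m1 ht))
    · rw [e2 ht]; exact hγb (m2 ht)
  · simp [hg, hs]
  · rw [e2 ⟨by norm_num, le_rfl⟩]; norm_num
  · have hsplit := eVariationOn.Icc_add_Icc (φ ∘ g) (s := univ) (a := (0 : ℝ)) (b := 1 / 2) (c := 1)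
      (by norm_num) (by norm_num) (mem_univ _)
    simp only [univ_inter] at hsplit
    rw [← hsplit]
    refine add_le_add ?_ ?_
    · have h1 : eVariationOn (φ ∘ g) (Icc 0 (1 / 2))
          = eVariationOn ((φ ∘ s) ∘ fun t => 2 * t) (Icc 0 (1 / 2)) :=
        eVariationOn.eq_of_eqOn fun t ht => by
          simp only [Function.comp_apply]; rw [e1 ht]; rfl
      rw [h1]
      refine (eVariationOn.comp_le_of_monotoneOn _ _
        (fun a _ b _ h => by simpa using h) m1).trans ?_
      refine (hφ.comp_eVariationOn_le hsS).trans ?_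
      gcongr
      have hsl : LipschitzOnWith (nndist w z) s univ := by
        refine LipschitzOnWith.of_dist_le_mul fun a _ b _ => ?_
        simp only [hs]
        rw [dist_lineMap_lineMap, mul_comm, coe_nndist]
      have h2 := hsl.comp_eVariationOn_le (g := fun t : ℝ => t) (s := Icc 0 1) (mapsTo_univ _ _)
      have h3 := (monotone_id (α := ℝ)).monotoneOn univ |>.eVariationOn_eq (mem_univ 0) (mem_univ 1)
      simp only [univ_inter, id] at h3
      calc eVariationOn s (Icc 0 1) ≤ nndist w z * eVariationOn (fun t : ℝ => t) (Icc 0 1) := h2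
        _ ≤ nndist w z * ENNReal.ofReal (1 - 0) := by gcongr; exact h3.le
        _ = edist w z := by rw [sub_zero, ENNReal.ofReal_one, mul_one, edist_nndist]
    · have h1 : eVariationOn (φ ∘ g) (Icc (1 / 2) 1)
          = eVariationOn ((φ ∘ γ) ∘ fun t => 2 * t - 1) (Icc (1 / 2) 1) :=
        eVariationOn.eq_of_eqOn fun t ht => by
          simp only [Function.comp_apply]; rw [e2 ht]; rfl
      rw [h1]
      exact eVariationOn.comp_le_of_monotoneOn _ _ (fun a _ b _ h => by simpa using h) m2

end Length

/-! ### Semicontinuity of the surface distance and compact metric disks -/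

section SurfaceDistance

variable {n : ℕ} {φ : ℂ → EuclideanSpace ℂ (Fin n)}

/-- By injectivity a competitor for φ(z) starts at z itself; the segment from w to z, in a ball
where φ is Lipschitz, is put in front of it. -/
theorem exists_surfaceEDist_le_add (hφ : DifferentiableOn ℂ φ (ball 0 1))
    (hinj : InjOn φ (ball 0 1)) {w : ℂ} (hw : w ∈ ball (0 : ℂ) 1)
    (Q : EuclideanSpace ℂ (Fin n)) :
    ∃ C : NNReal, ∀ᶠ z in nhds w,
      surfaceEDist φ (φ w) Q ≤ C * edist w z + surfaceEDist φ (φ z) Q := by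
  have hstrict : HasStrictDerivAt φ (deriv φ w) w :=
    (hφ.analyticAt (isOpen_ball.mem_nhds hw)).hasStrictDerivAt
  obtain ⟨C, s, hs, hC⟩ := hstrict.hasStrictFDerivAt.exists_lipschitzOnWith
  obtain ⟨δ, hδ, hball⟩ := Metric.mem_nhds_iff.1 (Filter.inter_mem hs (isOpen_ball.mem_nhds hw))
  refine ⟨C, ?_⟩
  filter_upwards [ball_mem_nhds w hδ] with z hz
  conv_rhs => rw [surfaceEDist]
  simp only [ENNReal.add_iInf]
  refine le_iInf fun γ => le_iInf fun hγ => le_iInf fun hγb => le_iInf fun h0 => le_iInf fun h1 => ?_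
  have hγ0 : γ 0 = z := hinj (hγb ⟨le_rfl, zero_le_one⟩) (hball hz).2 h0
  obtain ⟨g, g1, g2, g3, g4, g5⟩ := exists_concat_segment (convex_ball w δ)
    (fun x hx => (hball hx).2) (hC.mono fun x hx => (hball hx).1) (mem_ball_self hδ) hz hγ hγb hγ0
  refine le_trans ?_ g5
  exact iInf_le_of_le g (iInf_le_of_le g1 (iInf_le_of_le g2 (iInf_le_of_le (by rw [g3])
    (iInf_le_of_le (by rw [g4, h1]) le_rfl))))

theorem lowerSemicontinuousAt_surfaceEDist (hφ : DifferentiableOn ℂ φ (ball 0 1))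
    (hinj : InjOn φ (ball 0 1)) {w : ℂ} (hw : w ∈ ball (0 : ℂ) 1)
    (Q : EuclideanSpace ℂ (Fin n)) :
    LowerSemicontinuousAt (fun z => surfaceEDist φ (φ z) Q) w := by
  obtain ⟨C, hC⟩ := exists_surfaceEDist_le_add hφ hinj hw Q
  intro y hy
  have hlim : Filter.Tendsto (fun z => C * edist w z + y) (nhds w) (nhds y) := by
    have h1 : Filter.Tendsto (fun z => edist w z) (nhds w) (nhds 0) := by
      have := (continuous_const.edist continuous_id : Continuous fun z : ℂ => edist w z).tendsto w
      simpa using this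
    have h2 := (ENNReal.Tendsto.const_mul (a := (C : ℝ≥0∞)) h1 (Or.inr ENNReal.coe_ne_top)).add_const y
    simpa using h2
  filter_upwards [hC, hlim.eventually (gt_mem_nhds hy)] with z h1 h2
  by_contra h
  exact absurd ((h1.trans (add_le_add_right (not_lt.1 h) _)).trans_lt h2) (lt_irrefl _)

/-- The lower bound confines the metric disk to a closed disk of radius r < 1, and lower
semicontinuity makes it closed. -/
theorem containsMetricDisk_of_le {Λ : ℝ → ℝ} {R : ℝ}
    (hφ : DifferentiableOn ℂ φ (ball 0 1)) (hinj : InjOn φ (ball 0 1))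
    (hΛ : ∀ z ∈ ball (0 : ℂ) 1, ENNReal.ofReal (Λ ‖z‖) ≤ surfaceEDist φ (φ z) (φ 0))
    (hR : ∀ ρ < R, 0 ≤ ρ → ∃ r < 1, ∀ x, r < x → x < 1 → ρ < Λ x) :
    ContainsMetricDisk φ 0 R := by
  intro ρ hρ0 hρR
  obtain ⟨r, hr, hrΛ⟩ := hR ρ hρR hρ0
  set S := {z : ℂ | z ∈ ball (0 : ℂ) 1 ∧ surfaceEDist φ (φ z) (φ 0) ≤ ENNReal.ofReal ρ}
  have hSr : S ⊆ closedBall 0 r := by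
    intro z hz
    rw [mem_closedBall_zero_iff]
    by_contra h
    have h1 := hrΛ ‖z‖ (not_le.1 h) (mem_ball_zero_iff.1 hz.1)
    have h2 := (hΛ z hz.1).trans hz.2
    rw [ENNReal.ofReal_le_ofReal_iff hρ0] at h2
    linarith
  refine (isCompact_closedBall (0 : ℂ) r).of_isClosed_subset ?_ hSr
  rw [← isOpen_compl_iff, isOpen_iff_mem_nhds]
  intro z hz
  by_cases hzb : z ∈ ball (0 : ℂ) 1
  · have hlt : ENNReal.ofReal ρ < surfaceEDist φ (φ z) (φ 0) := by
      by_contra h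
      exact hz ⟨hzb, not_lt.1 h⟩
    filter_upwards [lowerSemicontinuousAt_surfaceEDist hφ hinj hzb (φ 0) _ hlt] with w hw hwS
    exact absurd hwS.2 (not_le.2 hw)
  · have h1 : z ∈ (closedBall (0 : ℂ) r)ᶜ := fun h => hzb (closedBall_subset_ball hr h)
    exact Filter.mem_of_superset (isClosed_closedBall.isOpen_compl.mem_nhds h1)
      (compl_subset_compl.2 hSr)

end SurfaceDistance

/-! ### Continuity of Ψ up to the endpoint -/

section Extremal

variable {p U : ℝ → ℝ}

/-- The integrand is at most 1 on (0,1), hence integrable up to the endpoint 1, whatever value U has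
there. -/
theorem continuousOn_extremalPsi (hUc : ContinuousOn U (Ioo (-1) 1))
    (hU : ∀ x ∈ Ioo (-1 : ℝ) 1, 1 ≤ U x ^ 2) : ContinuousOn (extremalPsi U) (Icc 0 1) := by
  have hsub : Ioo (0 : ℝ) 1 ⊆ Ioo (-1) 1 := Ioo_subset_Ioo_left (by norm_num)
  have hc : ContinuousOn (fun t => (U t ^ 2)⁻¹) (Ioo 0 1) :=
    ((hUc.mono hsub).pow 2).inv₀ fun t ht => by
      have := hU t (hsub ht); positivity
  have hint : IntervalIntegrable (fun t => (U t ^ 2)⁻¹) MeasureTheory.volume 0 1 := by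
    rw [intervalIntegrable_iff_integrableOn_Ioo_of_le zero_le_one]
    refine MeasureTheory.IntegrableOn.of_bound (by simp)
      (hc.aestronglyMeasurable measurableSet_Ioo) 1 ?_
    filter_upwards [MeasureTheory.ae_restrict_mem measurableSet_Ioo] with t ht
    have := hU t (hsub ht)
    rw [Real.norm_eq_abs, abs_of_nonneg (by positivity)]
    exact inv_le_one_of_one_le₀ this
  have := intervalIntegral.continuousOn_primitive_interval' hint (left_mem_uIcc (a := (0 : ℝ)))
  rwa [uIcc_of_le zero_le_one] at this

end Extremal

/-! ### The main theorem -/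

theorem theorem4 {n : ℕ} (φ : ℂ → EuclideanSpace ℂ (Fin n)) (p U : ℝ → ℝ)
    (hp : IsNehariFunction p)
    (hpmono : MonotoneOn p (Ico 0 1))
    (hφ : DifferentiableOn ℂ φ (ball 0 1))
    (hφ' : ∀ z ∈ ball (0 : ℂ) 1, deriv φ z ≠ 0)
    (hcrit : ∀ z ∈ ball (0 : ℂ) 1,
      ‖holSchwarzian φ z‖ + 3 / 4 * ‖deriv φ z‖ ^ 2 * |gaussCurvature φ z| ≤ 2 * p ‖z‖)
    (hnorm : ‖deriv φ 0‖ = 1)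
    (hU : SolvesLinearODE p U) (hU0 : U 0 = 1) (hU0' : deriv U 0 = 0) :
    (∀ r : ℝ, 0 ≤ r → r < 1 →
      ∃ m : ℝ≥0∞, IsLeast ((fun z => surfaceEDist φ (φ z) (φ 0)) '' sphere (0 : ℂ) r) m ∧
        ENNReal.ofReal
          (2 * extremalPsi U r / (2 + ‖deriv (deriv φ) 0‖ * extremalPsi U r)) ≤ m) ∧
    ContainsMetricDisk φ 0
      (2 * extremalPsi U 1 / (2 + ‖deriv (deriv φ) 0‖ * extremalPsi U 1)) := by
  have hS : ∀ z ∈ ball (0 : ℂ) 1,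
      ‖schwarzianForm (deriv φ z) (deriv (deriv φ) z) (deriv (deriv (deriv φ)) z)‖
        + 3 / 2 * curvatureForm (deriv φ z) (deriv (deriv φ) z) ≤ 2 * p ‖z‖ := by
    intro z hz
    have h1 := hcrit z hz
    rw [holSchwarzian_eq isOpen_ball hφ hφ' hz, mul_assoc,
      norm_sq_mul_abs_gaussCurvature isOpen_ball hφ hφ' hz] at h1
    linarith
  have hinj := hp.injOn_ball hφ hφ' hS
  have hpnn : ∀ x ∈ Ioo (-1 : ℝ) 1, 0 ≤ p x := fun x hx => (hp.pos x hx).le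
  have hUpos : ∀ x ∈ Ioo (-1 : ℝ) 1, 0 < U x := fun x hx =>
    (hU.pos_and_one_le_sq hU0 hU0' hpnn hx).1
  have hUsq : ∀ x ∈ Ioo (-1 : ℝ) 1, 1 ≤ U x ^ 2 := fun x hx =>
    (hU.pos_and_one_le_sq hU0 hU0' hpnn hx).2
  have hUc : ContinuousOn U (Ioo (-1) 1) := fun t ht => (hU t ht).1.continuousAt.continuousWithinAt
  have hsub : Ico (0 : ℝ) 1 ⊆ Ioo (-1) 1 := fun t ht => ⟨by linarith [ht.1], ht.2⟩
  set K := ‖deriv (deriv φ) 0‖ with hK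
  have hK0 : 0 ≤ K := norm_nonneg _
  set Λ : ℝ → ℝ := fun x => 2 * extremalPsi U x / (2 + K * extremalPsi U x) with hΛ
  have hden : ∀ x, 0 ≤ x → 0 < 2 + K * extremalPsi U x := fun x hx => by
    have := extremalPsi_nonneg (U := U) hx
    positivity
  -- The derivative Ψ'/(1 + KΨ/2)² is precisely the lower bound for |φ'| on the circle of radius x.
  have hΛd : ∀ x ∈ Ico (0 : ℝ) 1,
      HasStrictDerivAt Λ ((U x * (1 + K / 2 * extremalPsi U x)) ^ 2)⁻¹ x := by
    intro x hx
    have h1 := hasStrictDerivAt_extremalPsi hUc (fun s hs => (hUpos s hs).ne') (hsub hx)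
    have h2 := hden x hx.1
    have h3 := (hUpos x (hsub hx)).ne'
    refine ((h1.const_mul 2).div ((h1.const_mul K).const_add 2) h2.ne').congr_deriv ?_
    have h4 : 1 + K / 2 * extremalPsi U x = (2 + K * extremalPsi U x) / 2 := by ring
    rw [h4]
    field_simp
    ring
  have hmain : ∀ z ∈ ball (0 : ℂ) 1, ENNReal.ofReal (Λ ‖z‖) ≤ surfaceEDist φ (φ z) (φ 0) := by
    intro z hz
    rw [surfaceEDist]
    refine le_iInf fun γ => le_iInf fun hγ => le_iInf fun hγb => le_iInf fun h0 => le_iInf fun h1 => ?_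
    have hγ0 : γ 0 = z := hinj (hγb ⟨le_rfl, zero_le_one⟩) hz h0
    have hγ1 : γ 1 = 0 := hinj (hγb ⟨zero_le_one, le_rfl⟩) (mem_ball_self one_pos) h1
    have h2 := edist_le_eVariationOn_of_norm_deriv_ge (φ := φ) (φ' := deriv φ)
      (fun w hw => (hφ.analyticAt (isOpen_ball.mem_nhds hw)).hasStrictDerivAt) hφ' hΛd
      (fun x _ => by positivity)
      (fun w hw => hp.norm_deriv_ge hU hU0 hU0' hφ hφ' hS hnorm hw) hγ hγb
    have hΛ0 : Λ 0 = 0 := by simp [hΛ, extremalPsi]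
    rw [hγ0, hγ1, norm_zero, hΛ0, edist_dist, Real.dist_eq, sub_zero] at h2
    exact (ENNReal.ofReal_le_ofReal (le_abs_self _)).trans h2
  refine ⟨fun r hr0 hr1 => ?_, containsMetricDisk_of_le hφ hinj hmain fun ρ hρ _ => ?_⟩
  · have hsph : sphere (0 : ℂ) r ⊆ ball 0 1 := fun z hz => by
      rw [mem_ball, mem_sphere.1 hz]; exact hr1
    obtain ⟨z, hz, hmin⟩ := LowerSemicontinuousOn.exists_isMinOn
      (NormedSpace.sphere_nonempty.2 hr0) (isCompact_sphere (0 : ℂ) r)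
      (fun w hw => (lowerSemicontinuousAt_surfaceEDist hφ hinj (hsph hw)
        (φ 0)).lowerSemicontinuousWithinAt _)
    refine ⟨_, ⟨⟨z, hz, rfl⟩, ?_⟩, ?_⟩
    · rintro _ ⟨w, hw, rfl⟩
      exact hmin hw
    · have := hmain z (hsph hz)
      rwa [mem_sphere_zero_iff_norm.1 hz] at this
  · have hΨc := continuousOn_extremalPsi hUc hUsq
    have hΛc : ContinuousWithinAt Λ (Icc 0 1) 1 :=
      (((hΨc.const_smul (2 : ℝ)).div ((hΨc.const_smul K).const_add 2)
        fun x hx => (hden x hx.1).ne') 1 ⟨zero_le_one, le_rfl⟩)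
    -- Left continuity of Λ at 1, where its value is the radius R, lets every ρ < R be exceeded near
    -- the boundary.
    have hev : ∀ᶠ x in nhdsWithin 1 (Iio 1), ρ < Λ x := by
      have : ContinuousWithinAt Λ (Iio 1) 1 := hΛc.mono_of_mem_nhdsWithin
        (Filter.mem_of_superset (Ioo_mem_nhdsLT (zero_lt_one' ℝ)) Ioo_subset_Icc_self)
      exact this.eventually (lt_mem_nhds hρ)
    obtain ⟨r, hr, hsubr⟩ := mem_nhdsLT_iff_exists_Ioo_subset.1 hev
    exact ⟨r, hr, fun x h1 h2 => hsubr ⟨h1, h2⟩⟩
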